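/- Conventions. A $C^*$-quantum groupoid (weak Hopf $C^*$-algebra) is a quadruple $(A,\Delta,\kappa,\epsilon)$, where $A$ is a finite-dimensional $C^*$-algebra; $\Delta:A\to A\otimes A$ is a (not necessarily unital) coassociative $*$-homomorphism; $\kappa:A\to A$ is linear and antimultiplicative with $(\kappa\circ *)^2=\mathrm{id}$, $(\kappa\otimes\kappa)\Delta=\varsigma\Delta\kappa$ ($\varsigma$ the flip) and $(m(\kappa\otimes i)\otimes i)(\Delta\otimes i)\Delta(x)=(1\otimes x)\Delta(1)$ for all $x$ ($m$ the multiplication); and $\epsilon$ is a positive linear form with $(\epsilon\otimes i)\Delta=(i\otimes\epsilon)\Delta=i$ and $(\epsilon\otimes\epsilon)((x\otimes1)\Delta(1)(1\otimes y))=\epsilon(xy)$ for all $x,y$. Its Cartan subalgebras are $$A_t=\{x:\Delta(x)=\Delta(1)(x\otimes1)=(x\otimes1)\Delta(1)\},\qquad A_s=\{x:\Delta(x)=\Delta(1)(1\otimes x)=(1\otimes x)\Delta(1)\}.$$ For matrix units $(e^\gamma_{i,j})_{1\le i,j\le n_\gamma}$ of $A_t$ the canonical conditional expectation onto the center of $A_t$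 is $E_{Z(A_t)}(x)=\sum_{\gamma,i,j}\frac1{n_\gamma}e^\gamma_{i,j}\,x\,e^\gamma_{j,i}$. The canonical element of $(A,\Delta,\kappa,\epsilon)$ is the unique $q\in A_t$ such that, for all matrix units of $A_t$, $\Delta(1)=\sum_{\gamma,i,j}\frac1{n_\gamma}\kappa^{-1}(e^\gamma_{i,j}q)\otimes e^\gamma_{j,i}$. An isomorphism of $C^*$-quantum groupoids is an isomorphism of algebras that preserves the involution, the coproduct, the antipode and the counit. Statement. Let $(A,\Delta,\kappa,\epsilon)$ be a $C^*$-quantum groupoid whose Cartan subalgebras are not abelian (that is, $A_t$ or, equivalently, $A_s$ is not commutative). Then the canonical element $q$ exists and is unique. Let $D$ be the set of positive invertible $k\in A_t$ with $\kappa^2(k)=k$ and $E_{Z(A_t)}(k^{-1}q)=1$. For $k\in D$ let $A_k$ be the algebra $A$ with the involution $a^{*_k}=ka^*k^{-1}$, and put $$\Delta_k(a)=\Delta(a)(1\otimes k^{-1}),\qquad \kappa_k(a)=k\kappa(a)k^{-1},\qquad \epsilon_k(a)=\epsilon(ak).$$ 1. For every $k\in D$, the quadruple $(A_k,\Delta_k,\kappa_k,\epsilon_k)$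 is a $C^*$-quantum groupoid with the same underlying algebra and the same Cartan subalgebras $A_t$, $A_s$, and its canonical element is $k^{-1}q$. 2. There is $k\in D$ such that the antipode $\kappa_k$ is non-involutive on the Cartan subalgebras: $\kappa_k^2\ne\mathrm{id}$ on $A_t$ and $\kappa_k^2\ne\mathrm{id}$ on $A_s$. 3. If $k,k'\in D$ and $(A_k,\Delta_k,\kappa_k,\epsilon_k)$ is isomorphic to $(A_{k'},\Delta_{k'},\kappa_{k'},\epsilon_{k'})$, then $k^{-1}q$ and $k'^{-1}q$ have the same spectrum. 4. There is an uncountable subset $K\subset D$ such that, for all $k\ne k'$ in $K$, the spectra of $k^{-1}q$ and $k'^{-1}q$ are different and $(A_k,\Delta_k,\kappa_k,\epsilon_k)$ and $(A_{k'},\Delta_{k'},\kappa_{k'},\epsilon_{k'})$ are not isomorphic. So there are uncountably many pairwise non-isomorphic $C^*$-quantum groupoids with the same underlying algebra as $A$. -/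

import Mathlib

open scoped TensorProduct ComplexOrder ComplexConjugate

noncomputable section

/-- The structure maps of a finite quantum groupoid on a complex algebra `A`: an involution, a
coproduct, an antipode and a counit. The axioms are in `QuantumGroupoidData.IsCStarQuantumGroupoid`;
they are kept apart from the maps because a deformation is given by formulas for the maps, and that
the axioms hold for the deformed maps is something to prove. -/
@[ext]
structure QuantumGroupoidData (A : Type*) [Ring A] [Algebra ℂ A] where
  /-- the (conjugate linear) involution `x ↦ x*` -/
  star : A →ₗ⋆[ℂ] A
  /-- the coproduct `Δ` -/
  comul : A →ₗ[ℂ] A ⊗[ℂ] A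
  /-- the antipode `κ` -/
  antipode : A →ₗ[ℂ] A
  /-- the counit `ε` -/
  counit : A →ₗ[ℂ] ℂ

/-- `s` is an involution that makes the complex algebra `A` a C*-algebra. It is used for finite
dimensional `A` only, where every algebra norm is complete. -/
structure IsCStarInvolution {A : Type*} [Ring A] [Algebra ℂ A] (s : A →ₗ⋆[ℂ] A) : Prop where
  invol : ∀ x, s (s x) = x
  antimul : ∀ x y, s (x * y) = s y * s x
  exists_norm : ∃ ν : AlgebraNorm ℂ A, ∀ x, ν (s x * x) = ν x ^ 2

/-- A complete system of matrix units `e γ i j` of `N ⊆ A`, where `N` is (the underlying set of) a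
finite dimensional semisimple unital subalgebra of `A`, so that `N ≅ ⨁ γ, M_{n γ}(ℂ)`. The sums
`∑ γ i j, (1 / n γ) e γ i j ⊗ e γ j i` and `∑ γ i j, (1 / n γ) e γ i j * x * e γ j i` do not depend
on the system, and so `(e γ i j)* = e γ j i` is not required. -/
structure MatrixUnits {A : Type*} [Ring A] [Algebra ℂ A] (N : Set A) where
  /-- the number of blocks -/
  r : ℕ
  /-- the sizes of the blocks -/
  n : Fin r → ℕ
  n_pos : ∀ γ, 0 < n γ
  /-- the matrix units -/
  e : (γ : Fin r) → Fin (n γ) → Fin (n γ) → A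
  mul_same : ∀ γ i j k l, e γ i j * e γ k l = if j = k then e γ i l else 0
  mul_ne : ∀ γ γ', γ ≠ γ' → ∀ i j k l, e γ i j * e γ' k l = 0
  sum_diag : ∑ γ, ∑ i, e γ i i = 1
  linInd : LinearIndependent ℂ
    (fun t : (γ : Fin r) × (Fin (n γ) × Fin (n γ)) => e t.1 t.2.1 t.2.2)
  span_eq : (Submodule.span ℂ (Set.range
    (fun t : (γ : Fin r) × (Fin (n γ) × Fin (n γ)) => e t.1 t.2.1 t.2.2)) : Set A) = N

/-- The value at `x ∈ N` of the canonical (trace preserving) conditional expectation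
`E_{Z(N)} : N → Z(N)` onto the center of `N`, `E_{Z(N)}(x) = ∑ γ i j, (1 / n γ) e γ i j * x * e γ j i`. -/
def MatrixUnits.centralExpectation {A : Type*} [Ring A] [Algebra ℂ A] {N : Set A}
    (u : MatrixUnits N) (x : A) : A :=
  ∑ γ, ∑ i, ∑ j, ((u.n γ : ℂ)⁻¹) • (u.e γ i j * x * u.e γ j i)

namespace QuantumGroupoidData

variable {A : Type*} [Ring A] [Algebra ℂ A]

/-- The involution `(x ⊗ y)* = x* ⊗ y*` on `A ⊗ A`. -/
def tensorStar (G : QuantumGroupoidData A) : A ⊗[ℂ] A →ₗ⋆[ℂ] A ⊗[ℂ] A :=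
  TensorProduct.map G.star G.star

/-- The axioms of a C*-quantum groupoid (weak Hopf C*-algebra); `A` is finite dimensional. -/
structure IsCStarQuantumGroupoid (G : QuantumGroupoidData A) : Prop where
  finite : FiniteDimensional ℂ A
  /-- `A` is a C*-algebra -/
  cstar : IsCStarInvolution G.star
  /-- `Δ` is a (not necessarily unital) `*`-homomorphism -/
  comul_mul : ∀ x y, G.comul (x * y) = G.comul x * G.comul y
  comul_star : ∀ x, G.comul (G.star x) = G.tensorStar (G.comul x)
  /-- `(Δ ⊗ i)Δ = (i ⊗ Δ)Δ` -/
  coassoc : ∀ x, TensorProduct.assoc ℂ A A A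
      (TensorProduct.map G.comul LinearMap.id (G.comul x)) =
    TensorProduct.map LinearMap.id G.comul (G.comul x)
  /-- `(κ ∘ *)² = i` -/
  antipode_star : ∀ x, G.antipode (G.star (G.antipode (G.star x))) = x
  antipode_mul : ∀ x y, G.antipode (x * y) = G.antipode y * G.antipode x
  /-- `(κ ⊗ κ)Δ = ς Δ κ` with the flip `ς` -/
  antipode_comul : ∀ x, TensorProduct.map G.antipode G.antipode (G.comul x) =
    TensorProduct.comm ℂ A A (G.comul (G.antipode x))
  /-- `(m(κ ⊗ i) ⊗ i)(Δ ⊗ i)Δ(x) = (1 ⊗ x)Δ(1)` -/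
  antipode_axiom : ∀ x, TensorProduct.map
      (LinearMap.mul' ℂ A ∘ₗ TensorProduct.map G.antipode LinearMap.id) LinearMap.id
      (TensorProduct.map G.comul LinearMap.id (G.comul x)) = (1 ⊗ₜ[ℂ] x) * G.comul 1
  /-- `ε` is a positive linear form -/
  counit_pos : ∀ x, 0 ≤ G.counit (G.star x * x)
  /-- `(ε ⊗ i)Δ = i` -/
  counit_left : ∀ x, TensorProduct.lid ℂ A
    (TensorProduct.map G.counit LinearMap.id (G.comul x)) = x
  /-- `(i ⊗ ε)Δ = i` -/
  counit_right : ∀ x, TensorProduct.rid ℂ A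
    (TensorProduct.map LinearMap.id G.counit (G.comul x)) = x
  /-- `(ε ⊗ ε)((x ⊗ 1)Δ(1)(1 ⊗ y)) = ε(xy)` -/
  counit_mul : ∀ x y, LinearMap.mul' ℂ ℂ (TensorProduct.map G.counit G.counit
    ((x ⊗ₜ[ℂ] 1) * G.comul 1 * (1 ⊗ₜ[ℂ] y))) = G.counit (x * y)

/-- The target Cartan subalgebra `A_t`. -/
def target (G : QuantumGroupoidData A) : Set A :=
  {x | G.comul x = G.comul 1 * (x ⊗ₜ[ℂ] 1) ∧ G.comul x = (x ⊗ₜ[ℂ] 1) * G.comul 1}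

/-- The source Cartan subalgebra `A_s`. -/
def source (G : QuantumGroupoidData A) : Set A :=
  {x | G.comul x = G.comul 1 * (1 ⊗ₜ[ℂ] x) ∧ G.comul x = (1 ⊗ₜ[ℂ] x) * G.comul 1}

/-- `q` is the canonical element of `A_t`: `q ∈ A_t` and, for every system of matrix units of `A_t`,
`Δ(1) = ∑ γ i j, (1 / n γ) κ⁻¹(e γ i j * q) ⊗ e γ j i`. As `κ` is bijective, the equation is written
after application of `κ ⊗ i`. -/
def IsCanonical (G : QuantumGroupoidData A) (q : A) : Prop :=
  q ∈ G.target ∧ ∀ u : MatrixUnits G.target,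
    TensorProduct.map G.antipode LinearMap.id (G.comul 1) =
      ∑ γ, ∑ i, ∑ j, ((u.n γ : ℂ)⁻¹) • ((u.e γ i j * q) ⊗ₜ[ℂ] u.e γ j i)

/-- For the canonical element `q` of `A_t`, the elements `k` by which `G` is deformed: the positive
invertible `k ∈ A_t` with `κ²(k) = k` and `E_{Z(A_t)}(k⁻¹ q) = 1`. -/
structure IsDeformationElement (G : QuantumGroupoidData A) (q : A) (k : Aˣ) : Prop where
  mem : (k : A) ∈ G.target
  pos : ∃ b : A, (k : A) = G.star b * b
  antipode_sq : G.antipode (G.antipode k) = k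
  expectation : ∀ u : MatrixUnits G.target, u.centralExpectation ((↑k⁻¹ : A) * q) = 1

/-- The linear map `x ↦ k x k⁻¹`. -/
def conjMap (k : Aˣ) : A →ₗ[ℂ] A :=
  LinearMap.mulLeft ℂ (k : A) ∘ₗ LinearMap.mulRight ℂ (↑k⁻¹ : A)

/-- The deformation of `G` by `k`: `x^{*_k} = k x* k⁻¹`, `Δ_k(x) = Δ(x)(1 ⊗ k⁻¹)`,
`κ_k(x) = k κ(x) k⁻¹`, `ε_k(x) = ε(x k)`. -/
def deform (G : QuantumGroupoidData A) (k : Aˣ) : QuantumGroupoidData A where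
  star := (conjMap k).comp G.star
  comul := LinearMap.mulRight ℂ ((1 : A) ⊗ₜ[ℂ] (↑k⁻¹ : A)) ∘ₗ G.comul
  antipode := conjMap k ∘ₗ G.antipode
  counit := G.counit ∘ₗ LinearMap.mulRight ℂ (k : A)

/-- Isomorphism of C*-quantum groupoids: an isomorphism of algebras that preserves the involution,
the coproduct, the antipode and the counit. -/
def Iso {B : Type*} [Ring B] [Algebra ℂ B]
    (G : QuantumGroupoidData A) (H : QuantumGroupoidData B) : Prop :=
  ∃ φ : A ≃ₐ[ℂ] B,
    (∀ x, φ (G.star x) = H.star (φ x)) ∧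
    (∀ x, TensorProduct.map φ.toLinearMap φ.toLinearMap (G.comul x) = H.comul (φ x)) ∧
    (∀ x, φ (G.antipode x) = H.antipode (φ x)) ∧
    (∀ x, H.counit (φ x) = G.counit x)

end QuantumGroupoidData

end

/-! Write Δ(1) = ∑ x ⊗ y with x in A_s and y in A_t. The tensor (κ ⊗ i)Δ(1) intertwines a ⊗ 1 and 1
⊗ a for a in A_t, and a tensor with this property and second legs in A_t is s(q ⊗ 1), where s is the
symmetric separability element of A_t (`eq_sep_mul`). Flipped multiplication sends s to 1, so q = ∑
y κ(x) is forced (`isCanonical_iff`). Slicing with ε shows that q is invertible and that ε(· q) is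
the regular trace of A_t; since ε is positive and the regular trace is faithful, q is positive.
Moreover q κ²(a) = a q, so κ² on A_t is conjugation by q⁻¹.

The condition E(k⁻¹q) = 1 amounts to ∑ κ(x) k⁻¹ y = 1. It yields Δ(1)(1 ⊗ k⁻¹)Δ(1) = Δ(1), hence
multiplicativity of Δ_k (`comul_one_mul_mul_comul_one`), and also the antipode axiom of the
deformation. The condition κ²(k) = k says that k commutes with q and makes κ(k) self-adjoint. The
formula for q, applied to the deformation, gives k⁻¹q. As it involves only Δ(1), κ and the product,
an isomorphism preserves the canonical element and so its spectrum.

Examples come from k = q(1 + tg)⁻¹ with g ≠ 0 self-adjoint in A_t, commuting with q, and E(g) = 0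
(`exists_direction`). Then k⁻¹q = 1 + tg, whose spectrum determines t for small t > 0. Since E(g) =
0 ≠ g, the element g is not central in A_t, so κ_k² is not the identity there. -/

noncomputable section

/-! ### C*-involutions on finite dimensional algebras -/

namespace IsCStarInvolution

variable {A : Type*} [Ring A] [Algebra ℂ A] {s : A →ₗ⋆[ℂ] A}

theorem map_one (h : IsCStarInvolution s) : s 1 = 1 := by
  have := h.antimul (s 1) 1
  rw [mul_one, h.invol, mul_one] at this
  exact this.symm

/-- The normed ring structure given by an algebra norm. -/
abbrev normedRing (ν : AlgebraNorm ℂ A) : NormedRing A :=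
  { ν.toRingNorm.toNormedRing with
    toRing := inferInstance }

/-- The C*-algebra structure given by a C*-involution on a finite dimensional algebra. -/
abbrev toCStarAlgebra [FiniteDimensional ℂ A] (h : IsCStarInvolution s) : CStarAlgebra A :=
  letI ν := h.exists_norm.choose
  letI i₁ : NormedRing A := normedRing ν
  letI i₂ : NormedAlgebra ℂ A :=
    { (inferInstance : Algebra ℂ A) with
      norm_smul_le := fun c x => (map_smul_eq_mul ν c x).le }
  letI i₃ : StarRing A :=
    { star := s
      star_involutive := h.invol
      star_mul := h.antimul
      star_add := map_add s }
  have i₄ : CStarRing A := ⟨fun {x} => by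
    have := h.exists_norm.choose_spec x
    change ν x * ν x ≤ ν (s x * x)
    rw [this, sq]⟩
  have i₅ : StarModule ℂ A := ⟨fun c x => map_smulₛₗ s c x⟩
  { i₁, i₂, i₃, i₄, i₅ with
    toCompleteSpace := FiniteDimensional.complete ℂ A }

end IsCStarInvolution

/-! ### Semisimplicity, positivity and spectra in C*-algebras -/

section CStarAlgebra

attribute [local instance] CStarAlgebra.spectralOrder
attribute [local instance] CStarAlgebra.spectralOrderedRing

variable {B : Type*} [CStarAlgebra B]

theorem IsSelfAdjoint.eq_zero_of_isNilpotent {a : B} (ha : IsSelfAdjoint a)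
    (hn : IsNilpotent a) : a = 0 := by
  nontriviality B
  obtain ⟨n, hn⟩ := hn
  refine CFC.eq_zero_of_spectrum_subset_zero (R := ℂ) a fun z hz => ?_
  have := spectrum.pow_mem_pow a n hz
  rw [hn, spectrum.zero_eq, Set.mem_singleton_iff] at this
  exact eq_zero_of_pow_eq_zero this

/-- The Jacobson radical of an Artinian ring is nilpotent. For x in it, x*x is nilpotent and
self-adjoint, hence zero, and the C*-identity gives x = 0. -/
theorem CStarAlgebra.isSemisimpleRing [FiniteDimensional ℂ B] : IsSemisimpleRing B := by
  have : IsArtinianRing B := IsArtinianRing.of_finite ℂ B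
  rw [IsArtinianRing.isSemisimpleRing_iff_jacobson, eq_bot_iff]
  intro x hx
  obtain ⟨n, hn⟩ := IsSemiprimaryRing.isNilpotent (R := B)
  have h1 : star x * x ∈ Ring.jacobson B := Ideal.mul_mem_left _ _ hx
  have h2 : IsNilpotent (star x * x) := ⟨n, by
    have := Ideal.pow_mem_pow h1 n
    rw [hn] at this
    simpa using this⟩
  exact (CStarRing.star_mul_self_eq_zero_iff x).1
    ((IsSelfAdjoint.star_mul_self x).eq_zero_of_isNilpotent h2)

/-- The trace of the left multiplication by a positive element is positive and faithful. -/
theorem CStarAlgebra.eq_zero_of_trace_mulLeft_nonpos [FiniteDimensional ℂ B] {y : B} (hy : 0 ≤ y)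
    (ht : LinearMap.trace ℂ B (LinearMap.mulLeft ℂ y) ≤ 0) : y = 0 := by
  set T : Module.End ℂ B := LinearMap.mulLeft ℂ y with hT
  -- An eigenvector v of left multiplication satisfies (z - y)v = 0, so z - y is not invertible and
  -- z lies in the spectrum of y.
  have hroot : ∀ z ∈ T.charpoly.roots, 0 ≤ z := by
    intro z hz
    have h1 : T.HasEigenvalue z := by
      rw [Module.End.hasEigenvalue_iff_isRoot_charpoly]
      exact Polynomial.isRoot_of_mem_roots hz
    obtain ⟨v, hv⟩ := h1.exists_hasEigenvector
    have h2 : z ∈ spectrum ℂ y := by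
      rw [spectrum.mem_iff]
      intro hu
      have h3 : (algebraMap ℂ B z - y) * v = 0 := by
        have := hv.apply_eq_smul
        rw [hT, LinearMap.mulLeft_apply] at this
        rw [sub_mul, this, Algebra.algebraMap_eq_smul_one, smul_mul_assoc, one_mul, sub_self]
      exact hv.2 (hu.mul_right_eq_zero.1 h3)
    exact spectrum_nonneg_of_nonneg hy h2
  have htr : LinearMap.trace ℂ B T = T.charpoly.roots.sum :=
    Module.End.trace_eq_sum_roots_charpoly_of_splits (IsAlgClosed.splits _)
  have h0 : T.charpoly.roots.sum = 0 :=
    le_antisymm (htr ▸ ht) (Multiset.sum_nonneg hroot)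
  have hz := Multiset.all_zero_of_le_zero_le_of_sum_eq_zero hroot h0
  -- Nonnegative roots with nonpositive sum all vanish. So left multiplication by y is nilpotent,
  -- and with it y.
  have hX : T.charpoly = Polynomial.X ^ Module.finrank ℂ B := by
    have h1 := (IsAlgClosed.splits T.charpoly).eq_prod_roots_of_monic
      (LinearMap.charpoly_monic T)
    have h2 : T.charpoly.roots = Multiset.replicate (Multiset.card T.charpoly.roots) 0 :=
      Multiset.eq_replicate_card.2 fun b hb => hz b hb
    rw [h2] at h1
    simp only [Multiset.map_replicate, map_zero, sub_zero, Multiset.prod_replicate] at h1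
    rw [← LinearMap.charpoly_natDegree T]
    conv_rhs => rw [h1, Polynomial.natDegree_X_pow]
    exact h1
  obtain ⟨n, hn⟩ := (LinearMap.charpoly_eq_X_pow_iff T).1 hX 1
  have hn' : y ^ n = 0 := by
    rw [hT, LinearMap.pow_mulLeft, LinearMap.mulLeft_apply, mul_one] at hn
    exact hn
  exact hy.isSelfAdjoint.eq_zero_of_isNilpotent ⟨n, hn'⟩

/-- Since q⁻q = -(q⁻)², the trace of left multiplication by q⁻ is -ε((q⁻)²) ≤ 0, and faithfulness of
the trace on positive elements kills q⁻. -/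
theorem CStarAlgebra.nonneg_of_trace_mulLeft_eq [FiniteDimensional ℂ B] (ε : B →ₗ[ℂ] ℂ)
    (hε : ∀ x, 0 ≤ ε (star x * x)) {q : B} (hq : IsSelfAdjoint q)
    (htr : ∀ x, ε (x * q) = LinearMap.trace ℂ B (LinearMap.mulLeft ℂ x)) : 0 ≤ q := by
  have hneg : q⁻ * q = -(star q⁻ * q⁻) := by
    have h1 : q⁻ * (q⁺ - q⁻) = -(star q⁻ * q⁻) := by
      rw [mul_sub, CFC.negPart_mul_posPart, zero_sub,
        (CFC.negPart_nonneg q).isSelfAdjoint.star_eq]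
    rwa [CFC.posPart_sub_negPart q hq] at h1
  have h0 : q⁻ = 0 := by
    refine CStarAlgebra.eq_zero_of_trace_mulLeft_nonpos (CFC.negPart_nonneg q) ?_
    rw [← htr, hneg, map_neg]
    exact neg_nonpos.2 (hε _)
  exact (CFC.negPart_eq_zero_iff q hq).1 h0

/-- A perturbation of `1` along a self-adjoint direction which commutes with `q`. -/
theorem CStarAlgebra.exists_mul_inv_eq_star_mul_self {q h : B} (hq : 0 ≤ q) (hh : IsSelfAdjoint h)
    (hqh : Commute q h) {t : ℝ} (ht0 : 0 ≤ t) (ht : t * ‖h‖ < 1) :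
    IsUnit (1 + (t : ℂ) • h) ∧
      ∀ w : Bˣ, (w : B) = 1 + (t : ℂ) • h → ∃ b, q * (↑w⁻¹ : B) = star b * b := by
  have hn : ‖-((t : ℂ) • h)‖ < 1 := by
    rw [norm_neg, norm_smul, Complex.norm_real, Real.norm_of_nonneg ht0]
    exact ht
  refine ⟨by simpa using isUnit_one_sub_of_norm_lt_one hn, fun w hw => ?_⟩
  nontriviality B
  have hs : IsSelfAdjoint ((t : ℂ) • h) := by
    rw [isSelfAdjoint_iff, star_smul, hh.star_eq, Complex.star_def, Complex.conj_ofReal]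
  have hw0 : (0 : B) ≤ w := by
    have h1 := hs.neg_algebraMap_norm_le_self
    have h2 : algebraMap ℝ B ‖(t : ℂ) • h‖ ≤ 1 := by
      rw [← _root_.map_one (algebraMap ℝ B)]
      exact algebraMap_le_algebraMap.2 (by rw [← norm_neg]; exact hn.le)
    rw [hw]
    calc (0 : B) ≤ 1 - algebraMap ℝ B ‖(t : ℂ) • h‖ := sub_nonneg.2 h2
      _ ≤ 1 + (t : ℂ) • h := by rw [sub_eq_add_neg]; gcongr
  have hwi : (0 : B) ≤ (↑w⁻¹ : B) := by
    exact CFC.inv_nonneg_of_nonneg w hw0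
  have hc : Commute q (w : B) := by
    rw [hw]
    exact (Commute.one_right q).add_right (hqh.smul_right _)
  exact CStarAlgebra.nonneg_iff_eq_star_mul_self.1 (Commute.mul_nonneg hq hwi hc.units_inv_right)

-- The norm of a self-adjoint h is attained at some spectral point z. If the spectra agreed, then
-- t'z = tw with w in the spectrum of h, so t'‖h‖ ≤ t‖h‖, against t < t'.
open Pointwise in
theorem CStarAlgebra.spectrum_one_add_smul_ne {h : B} (hh : IsSelfAdjoint h) (h0 : h ≠ 0)
    {t t' : ℝ} (ht : 0 ≤ t) (htt : t < t') :
    spectrum ℂ (1 + (t : ℂ) • h) ≠ spectrum ℂ (1 + (t' : ℂ) • h) := by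
  intro heq
  have : Nontrivial B := ⟨h, 0, h0⟩
  have key : ∀ r : ℝ, spectrum ℂ (1 + (r : ℂ) • h) = {(1 : ℂ)} + (r : ℂ) • spectrum ℂ h := by
    intro r
    rw [← spectrum.smul_eq_smul _ _ (spectrum.nonempty h), spectrum.singleton_add_eq, _root_.map_one]
  obtain ⟨z, hz, hzr⟩ := spectrum.exists_nnnorm_eq_spectralRadius h
  rw [hh.spectralRadius_eq_nnnorm, ENNReal.coe_inj] at hzr
  have hz' : ‖z‖ = ‖h‖ := congrArg NNReal.toReal hzr
  have hmem : 1 + (t' : ℂ) * z ∈ spectrum ℂ (1 + (t : ℂ) • h) := by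
    rw [heq, key]
    exact Set.add_mem_add rfl (Set.smul_mem_smul_set hz)
  rw [key] at hmem
  obtain ⟨_, h1, _, ⟨w, hw, rfl⟩, h2⟩ := hmem
  rw [Set.mem_singleton_iff] at h1
  subst h1
  have h3 : (t : ℂ) * w = t' * z := by simpa using h2
  have h4 := congrArg norm h3
  rw [norm_mul, norm_mul, Complex.norm_real, Complex.norm_real, Real.norm_of_nonneg ht,
    Real.norm_of_nonneg (ht.trans htt.le), hz'] at h4
  have h5 : ‖w‖ ≤ ‖h‖ := spectrum.norm_le_norm_of_mem hw
  have h6 : 0 < ‖h‖ := norm_pos_iff.2 h0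
  nlinarith [mul_le_mul_of_nonneg_left h5 ht]

end CStarAlgebra

/-! ### Restriction, conjugation and perturbation for a bare involution -/

namespace IsCStarInvolution

variable {A : Type*} [Ring A] [Algebra ℂ A] {s : A →ₗ⋆[ℂ] A}

/-- The restriction of an involution to an invariant subalgebra. -/
def restrict (s : A →ₗ⋆[ℂ] A) (N : Subalgebra ℂ A) (hN : ∀ x ∈ N, s x ∈ N) : N →ₗ⋆[ℂ] N where
  toFun x := ⟨s x, hN x x.2⟩
  map_add' x y := Subtype.ext (map_add s (x : A) y)
  map_smul' c x := Subtype.ext (map_smulₛₗ s c (x : A))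

theorem restrict_isCStarInvolution (h : IsCStarInvolution s) (N : Subalgebra ℂ A)
    (hN : ∀ x ∈ N, s x ∈ N) : IsCStarInvolution (restrict s N hN) where
  invol x := Subtype.ext (h.invol x)
  antimul x y := Subtype.ext (h.antimul x y)
  exists_norm := by
    obtain ⟨ν, hν⟩ := h.exists_norm
    exact ⟨ν.restriction N, fun x => hν x⟩

/-- An algebra norm composed with the conjugation by a unit. -/
def conjNorm (ν : AlgebraNorm ℂ A) (c : Aˣ) : AlgebraNorm ℂ A where
  toFun x := ν (c * x * (↑c⁻¹ : A))
  map_zero' := by simp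
  add_le' x y := by rw [mul_add, add_mul]; exact map_add_le_add ν _ _
  neg' x := by rw [mul_neg, neg_mul]; exact map_neg_eq_map ν _
  mul_le' x y := by
    refine le_trans (le_of_eq (congrArg ν ?_)) (map_mul_le_mul ν _ _)
    simp only [mul_assoc, Units.inv_mul_cancel_left]
  eq_zero_of_map_eq_zero' x hx := by
    have := eq_zero_of_map_eq_zero ν hx
    simpa using this
  smul' a x := by
    rw [mul_smul_comm, smul_mul_assoc]; exact map_smul_eq_mul ν _ _

/-- For k = b*b, conjugation by d = (b*)⁻¹ carries the new involution to the old one: both d(k x*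
k⁻¹)d⁻¹ and (d x d⁻¹)* equal b x* b⁻¹. The C*-norm is therefore transported along this conjugation.
-/
theorem conjMap_comp (h : IsCStarInvolution s) (k : Aˣ) {b : A} (hb : (k : A) = s b * b)
    (hbu : IsUnit b) :
    IsCStarInvolution ((QuantumGroupoidData.conjMap k).comp s) := by
  have hk : s k = k := by rw [hb, h.antimul, h.invol]
  have hki : s (↑k⁻¹ : A) = ↑k⁻¹ := by
    rw [← Units.mul_eq_one_iff_eq_inv]
    conv_lhs => rw [← hk, ← h.antimul, Units.mul_inv, h.map_one]
  have hval : ∀ x, (QuantumGroupoidData.conjMap k).comp s x = k * (s x * (↑k⁻¹ : A)) :=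
    fun x => rfl
  refine ⟨fun x => ?_, fun x y => ?_, ?_⟩
  · simp only [hval, h.antimul, hk, hki, h.invol]
    simp [mul_assoc]
  · simp only [hval, h.antimul]
    simp [mul_assoc]
  · obtain ⟨ν, hν⟩ := h.exists_norm
    obtain ⟨c, rfl⟩ := hbu
    have hc : s c * s (↑c⁻¹ : A) = 1 := by rw [← h.antimul, Units.inv_mul, h.map_one]
    have hc' : s (↑c⁻¹ : A) * s c = 1 := by rw [← h.antimul, Units.mul_inv, h.map_one]
    have hkc : (↑k⁻¹ : A) = ↑c⁻¹ * s (↑c⁻¹ : A) := by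
      rw [eq_comm, ← Units.mul_eq_one_iff_eq_inv, hb, mul_assoc, ← mul_assoc _ _ (c : A), hc',
        one_mul, Units.inv_mul]
    let d : Aˣ := ⟨s (↑c⁻¹ : A), s c, hc', hc⟩
    refine ⟨conjNorm ν d, fun x => ?_⟩
    have := hν (s (↑c⁻¹ : A) * x * s c)
    change ν (s (↑c⁻¹ : A) * _ * s c) = ν (s (↑c⁻¹ : A) * x * s c) ^ 2
    rw [← this]
    congr 1
    simp only [hval, h.antimul, h.invol, hb, hkc, mul_assoc]
    rw [← mul_assoc (s _) (s _), hc', one_mul]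

variable [FiniteDimensional ℂ A]

theorem isSemisimpleRing (h : IsCStarInvolution s) : IsSemisimpleRing A :=
  letI := h.toCStarAlgebra
  CStarAlgebra.isSemisimpleRing (B := A)

theorem exists_eq_star_mul_self_of_trace (h : IsCStarInvolution s) (ε : A →ₗ[ℂ] ℂ)
    (hε : ∀ x, 0 ≤ ε (s x * x)) {q : A} (hq : s q = q)
    (htr : ∀ x, ε (x * q) = LinearMap.trace ℂ A (LinearMap.mulLeft ℂ x)) :
    ∃ b, q = s b * b := by
  let := h.toCStarAlgebra
  let := CStarAlgebra.spectralOrder A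
  let := CStarAlgebra.spectralOrderedRing A
  exact CStarAlgebra.nonneg_iff_eq_star_mul_self.1
    (CStarAlgebra.nonneg_of_trace_mulLeft_eq ε hε (q := q) hq htr)

/-- The bound `δ = ‖h‖⁻¹` keeps th in the open unit ball. Neither norm nor order enters the
conclusion, since both depend on an auxiliary C*-structure. -/
theorem exists_perturbation (hs : IsCStarInvolution s) {q h : A} (hq : ∃ b, q = s b * b)
    (hh : s h = h) (h0 : h ≠ 0) (hqh : Commute q h) :
    ∃ δ : ℝ, 0 < δ ∧ (∀ t ∈ Set.Ioo 0 δ, IsUnit (1 + (t : ℂ) • h) ∧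
      ∀ w : Aˣ, (w : A) = 1 + (t : ℂ) • h → ∃ b, q * (↑w⁻¹ : A) = s b * b) ∧
      ∀ t ∈ Set.Ioo 0 δ, ∀ t' ∈ Set.Ioo 0 δ, t ≠ t' →
        spectrum ℂ (1 + (t : ℂ) • h) ≠ spectrum ℂ (1 + (t' : ℂ) • h) := by
  let := hs.toCStarAlgebra
  let := CStarAlgebra.spectralOrder A
  let := CStarAlgebra.spectralOrderedRing A
  have hpos : 0 < ‖h‖ := norm_pos_iff.2 h0
  refine ⟨‖h‖⁻¹, inv_pos.2 hpos, fun t ht => ?_, fun t ht t' ht' hne => ?_⟩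
  · refine CStarAlgebra.exists_mul_inv_eq_star_mul_self (q := q) (h := h)
      (CStarAlgebra.nonneg_iff_eq_star_mul_self.2 hq) hh hqh ht.1.le ?_
    calc t * ‖h‖ < ‖h‖⁻¹ * ‖h‖ := mul_lt_mul_of_pos_right ht.2 hpos
      _ = 1 := inv_mul_cancel₀ hpos.ne'
  · rcases lt_or_gt_of_ne hne with hlt | hlt
    · exact CStarAlgebra.spectrum_one_add_smul_ne (h := h) hh h0 ht.1.le hlt
    · exact (CStarAlgebra.spectrum_one_add_smul_ne (h := h) hh h0 ht'.1.le hlt).symm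

end IsCStarInvolution


/-! ### Matrix units, the separability element and the regular trace -/

namespace MatrixUnits

variable {A : Type*} [Ring A] [Algebra ℂ A]

/-- Wedderburn–Artin over ℂ: the standard matrix units of the blocks are pulled back to the
subalgebra. -/
theorem nonempty_of_isSemisimpleRing [FiniteDimensional ℂ A] (N : Subalgebra ℂ A)
    [IsSemisimpleRing N] : Nonempty (MatrixUnits (N : Set A)) := by
  obtain ⟨n, d, hd, ⟨e⟩⟩ := IsSemisimpleRing.exists_algEquiv_pi_matrix_of_isAlgClosed ℂ N
  let b := (Pi.basis fun γ => Matrix.stdBasis ℂ (Fin (d γ)) (Fin (d γ))).map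
    e.symm.toLinearEquiv
  have hb : ∀ t, b t = e.symm (Pi.single t.1 (Matrix.single t.2.1 t.2.2 1)) := by
    intro t
    obtain ⟨γ, i, j⟩ := t
    simp [b, Matrix.stdBasis_eq_single]
  have hfun : (fun t : (γ : Fin n) × (Fin (d γ) × Fin (d γ)) =>
      ((e.symm (Pi.single t.1 (Matrix.single t.2.1 t.2.2 1)) : N) : A)) =
      N.val.toLinearMap ∘ b := by
    funext t
    rw [Function.comp_apply, hb]
    rfl
  refine ⟨
    { r := n
      n := d
      n_pos := fun γ => Nat.pos_of_ne_zero (hd γ).out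
      e := fun γ i j => ((e.symm (Pi.single γ (Matrix.single i j 1)) : N) : A)
      mul_same := fun γ i j k l => ?_
      mul_ne := fun γ γ' hne i j k l => ?_
      sum_diag := ?_
      linInd := ?_
      span_eq := ?_ }⟩
  · rw [← Subalgebra.coe_mul, ← map_mul, ← Pi.single_mul]
    split_ifs with hjk
    · subst hjk; simp
    · rw [Matrix.single_mul_single_of_ne _ _ _ _ hjk]; simp
  · rw [← Subalgebra.coe_mul, ← map_mul]
    have : (Pi.single γ (Matrix.single i j 1) * Pi.single γ' (Matrix.single k l 1) :
        Π γ : Fin n, Matrix (Fin (d γ)) (Fin (d γ)) ℂ) = 0 := by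
      funext δ
      rw [Pi.mul_apply, Pi.zero_apply]
      rcases eq_or_ne δ γ with rfl | h
      · rw [Pi.single_eq_of_ne hne, mul_zero]
      · rw [Pi.single_eq_of_ne h, zero_mul]
    rw [this]; simp
  · have : (∑ γ, ∑ i, Pi.single γ (Matrix.single i i 1) :
        Π γ : Fin n, Matrix (Fin (d γ)) (Fin (d γ)) ℂ) = 1 := by
      funext δ
      rw [Finset.sum_apply, Finset.sum_eq_single δ]
      · rw [Finset.sum_apply, Pi.one_apply]
        simp [Matrix.sum_single_one]
      · intro γ _ hne
        rw [Finset.sum_apply]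
        exact Finset.sum_eq_zero fun i _ => Pi.single_eq_of_ne hne.symm _
      · simp
    have h2 := congrArg (fun z => ((e.symm z : N) : A)) this
    simpa using h2
  · rw [hfun]
    exact b.linearIndependent.map' _ (LinearMap.ker_eq_bot.2 Subtype.val_injective)
  · rw [hfun, Set.range_comp, Submodule.span_image, b.span_eq, Submodule.map_top]
    ext x
    simp

variable {N : Set A} (u : MatrixUnits N)

theorem e_mem (γ : Fin u.r) (i j : Fin (u.n γ)) : u.e γ i j ∈ N := by
  have := Submodule.subset_span (R := ℂ) (Set.mem_range_self (f := fun t :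
    (γ : Fin u.r) × (Fin (u.n γ) × Fin (u.n γ)) => u.e t.1 t.2.1 t.2.2) ⟨γ, i, j⟩)
  exact u.span_eq.subset this

theorem induction {p : A → Prop} (he : ∀ γ i j, p (u.e γ i j)) (h0 : p 0)
    (hadd : ∀ x y, p x → p y → p (x + y)) (hsmul : ∀ (c : ℂ) x, p x → p (c • x)) {x : A}
    (hxN : x ∈ N) : p x := by
  have hx' := u.span_eq.superset hxN
  clear hxN
  rw [SetLike.mem_coe] at hx'
  induction hx' using Submodule.span_induction with
  | mem x h => obtain ⟨t, rfl⟩ := h; exact he _ _ _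
  | zero => exact h0
  | add x y h1 h2 hx hy => exact hadd x y hx hy
  | smul c x h1 hx => exact hsmul c x hx

/-- The symmetric separability element `∑ γ i j, (1 / n γ) e γ i j ⊗ e γ j i`. -/
def sep : A ⊗[ℂ] A :=
  ∑ γ, ∑ i, ∑ j, ((u.n γ : ℂ)⁻¹) • (u.e γ i j ⊗ₜ[ℂ] u.e γ j i)

/-- The map φ is left free so that the same collapse of the sum serves the tensor product and, in
`sum_mul_e`, its flip. -/
theorem e_mul_sum (δ : Fin u.r) (k l : Fin (u.n δ)) {V : Type*} [AddCommGroup V] [Module ℂ V]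
    (φ : A → A →ₗ[ℂ] V) (hφ : φ 0 = 0) :
    ∑ γ, ∑ i, ∑ j, ((u.n γ : ℂ)⁻¹) • φ (u.e δ k l * u.e γ i j) (u.e γ j i) =
      ((u.n δ : ℂ)⁻¹) • ∑ j, φ (u.e δ k j) (u.e δ j l) := by
  rw [Finset.sum_eq_single δ, Finset.sum_eq_single l, Finset.smul_sum]
  · simp [u.mul_same]
  · intro i _ hi
    simp [u.mul_same, hi.symm, hφ]
  · simp
  · intro γ _ hγ
    simp [u.mul_ne δ γ hγ.symm, hφ]
  · simp

theorem sum_mul_e (δ : Fin u.r) (k l : Fin (u.n δ)) {V : Type*} [AddCommGroup V] [Module ℂ V]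
    (φ : A → A →ₗ[ℂ] V) (hφ : φ 0 = 0) :
    ∑ γ, ∑ i, ∑ j, ((u.n γ : ℂ)⁻¹) • φ (u.e γ i j * u.e δ k l) (u.e γ j i) =
      ((u.n δ : ℂ)⁻¹) • ∑ j, φ (u.e δ j l) (u.e δ k j) := by
  rw [Finset.sum_eq_single δ, Finset.smul_sum]
  · simp [u.mul_same, apply_ite, ite_apply, hφ]
  · intro γ _ hγ
    simp [u.mul_ne γ δ hγ, hφ]
  · simp

/-- On a matrix unit e_kl of a block of size n, both sides collapse to (1/n) ∑_j e_kj ⊗ e_jl. -/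
theorem mul_sep_left {x : A} (hx : x ∈ N) :
    (x ⊗ₜ[ℂ] 1) * u.sep = u.sep * ((1 : A) ⊗ₜ[ℂ] x) := by
  refine u.induction (p := fun x => (x ⊗ₜ[ℂ] 1) * u.sep = u.sep * ((1 : A) ⊗ₜ[ℂ] x))
    (fun δ k l => ?_) ?_ (fun x y hx hy => ?_) (fun c x hx => ?_) hx
  · have h1 := u.e_mul_sum δ k l (TensorProduct.mk ℂ A A) (by simp)
    have h2 := u.sum_mul_e δ k l (TensorProduct.mk ℂ A A).flip (by simp)
    simp only [TensorProduct.mk_apply, LinearMap.flip_apply] at h1 h2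
    simp only [sep, Finset.mul_sum, Finset.sum_mul, mul_smul_comm, smul_mul_assoc,
      Algebra.TensorProduct.tmul_mul_tmul, one_mul, mul_one]
    rw [h1, ← h2]
    exact Finset.sum_congr rfl fun γ _ => Finset.sum_comm
  · simp
  · rw [TensorProduct.add_tmul, TensorProduct.tmul_add, add_mul, mul_add, hx, hy]
  · rw [TensorProduct.tmul_smul, ← TensorProduct.smul_tmul', smul_mul_assoc, mul_smul_comm, hx]

/-- The flip preserves the symmetric separability element. -/
theorem comm_sep : TensorProduct.comm ℂ A A u.sep = u.sep := by
  simp only [sep, map_sum, map_smul, TensorProduct.comm_tmul]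
  exact Finset.sum_congr rfl fun γ _ => Finset.sum_comm

theorem mul_sep_right {x : A} (hx : x ∈ N) :
    ((1 : A) ⊗ₜ[ℂ] x) * u.sep = u.sep * (x ⊗ₜ[ℂ] 1) := by
  have h := congrArg (Algebra.TensorProduct.comm ℂ A A) (u.mul_sep_left hx)
  have hc : Algebra.TensorProduct.comm ℂ A A u.sep = u.sep := u.comm_sep
  simpa [hc] using h

/-- The linear map `a ⊗ b ↦ a * x * b`. -/
def sandwich (x : A) : A ⊗[ℂ] A →ₗ[ℂ] A :=
  LinearMap.mul' ℂ A ∘ₗ TensorProduct.map (LinearMap.mulRight ℂ x) LinearMap.id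

@[simp]
theorem sandwich_tmul (x a b : A) : sandwich x (a ⊗ₜ[ℂ] b) = a * x * b := by
  simp [sandwich]

theorem sandwich_tmul_one_mul (x y : A) (z : A ⊗[ℂ] A) :
    sandwich x ((y ⊗ₜ[ℂ] 1) * z) = y * sandwich x z := by
  induction z with
  | zero => simp
  | tmul a b => simp [mul_assoc]
  | add z w hz hw => rw [mul_add, map_add, hz, hw, map_add, mul_add]

theorem sandwich_mul_one_tmul (x y : A) (z : A ⊗[ℂ] A) :
    sandwich x (z * (1 ⊗ₜ[ℂ] y)) = sandwich x z * y := by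
  induction z with
  | zero => simp
  | tmul a b => simp [mul_assoc]
  | add z w hz hw => rw [add_mul, map_add, hz, hw, map_add, add_mul]

theorem sandwich_mul_tmul_one (x y : A) (z : A ⊗[ℂ] A) :
    sandwich x (z * (y ⊗ₜ[ℂ] 1)) = sandwich (y * x) z := by
  induction z with
  | zero => simp
  | tmul a b => simp [mul_assoc]
  | add z w hz hw => rw [add_mul, map_add, hz, hw, map_add]

theorem centralExpectation_eq (x : A) : u.centralExpectation x = sandwich x u.sep := by
  simp [centralExpectation, sep]

theorem commute_centralExpectation (x : A) {y : A} (hy : y ∈ N) :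
    Commute y (u.centralExpectation x) := by
  rw [Commute, SemiconjBy, centralExpectation_eq, ← sandwich_tmul_one_mul, u.mul_sep_left hy,
    sandwich_mul_one_tmul]

theorem sum_e_mul_e :
    ∑ γ, ∑ i, ∑ j, ((u.n γ : ℂ)⁻¹) • (u.e γ i j * u.e γ j i) = 1 := by
  rw [← u.sum_diag]
  refine Finset.sum_congr rfl fun γ _ => Finset.sum_congr rfl fun i _ => ?_
  simp only [u.mul_same, if_true, Finset.sum_const, Finset.card_univ, Fintype.card_fin]
  rw [← Nat.cast_smul_eq_nsmul ℂ, smul_smul, mul_inv_cancel₀, one_smul]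
  exact Nat.cast_ne_zero.2 (u.n_pos γ).ne'

theorem sandwich_one_sep : sandwich 1 u.sep = 1 := by
  simp only [sep, map_sum, map_smul, sandwich_tmul, mul_one, u.sum_e_mul_e]

theorem centralExpectation_of_commute {x : A} (hx : ∀ y ∈ N, Commute x y) :
    u.centralExpectation x = x := by
  calc u.centralExpectation x = x * ∑ γ, ∑ i, ∑ j, ((u.n γ : ℂ)⁻¹) • (u.e γ i j * u.e γ j i) := by
        simp only [centralExpectation, Finset.mul_sum, mul_smul_comm, ← mul_assoc,
          (hx _ (u.e_mem _ _ _)).eq]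
    _ = x := by rw [u.sum_e_mul_e, mul_one]

theorem centralExpectation_add (x y : A) :
    u.centralExpectation (x + y) = u.centralExpectation x + u.centralExpectation y := by
  simp [centralExpectation, mul_add, add_mul, Finset.sum_add_distrib]

theorem centralExpectation_smul (c : ℂ) (x : A) :
    u.centralExpectation (c • x) = c • u.centralExpectation x := by
  simp [centralExpectation, Finset.smul_sum, smul_comm c]

theorem centralExpectation_mem {S : Subalgebra ℂ A} (u : MatrixUnits (S : Set A)) {x : A}
    (hx : x ∈ S) : u.centralExpectation x ∈ S :=
  Subalgebra.sum_mem _ fun γ _ => Subalgebra.sum_mem _ fun i _ => Subalgebra.sum_mem _ fun j _ =>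
    Subalgebra.smul_mem _ (Subalgebra.mul_mem _ (Subalgebra.mul_mem _ (u.e_mem γ i j) hx)
      (u.e_mem γ j i)) _

/-- The linear map `z ↦ ∑ γ i j, (1 / n γ) (e γ i j ⊗ 1) * z * (1 ⊗ e γ j i)`. -/
def twist : A ⊗[ℂ] A →ₗ[ℂ] A ⊗[ℂ] A :=
  ∑ γ, ∑ i, ∑ j, ((u.n γ : ℂ)⁻¹) • (LinearMap.mulLeft ℂ (u.e γ i j ⊗ₜ[ℂ] (1 : A)) ∘ₗ
    LinearMap.mulRight ℂ ((1 : A) ⊗ₜ[ℂ] u.e γ j i))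

theorem twist_apply (z : A ⊗[ℂ] A) : u.twist z = ∑ γ, ∑ i, ∑ j, ((u.n γ : ℂ)⁻¹) •
    ((u.e γ i j ⊗ₜ[ℂ] (1 : A)) * (z * ((1 : A) ⊗ₜ[ℂ] u.e γ j i))) := by
  simp [twist]

theorem twist_tmul (m : A) {p : A} (hp : p ∈ N) :
    u.twist (m ⊗ₜ[ℂ] p) = u.sep * ((p * m) ⊗ₜ[ℂ] 1) := by
  have : u.sep * ((p * m) ⊗ₜ[ℂ] (1 : A)) = ((1 : A) ⊗ₜ[ℂ] p) * u.sep * (m ⊗ₜ[ℂ] (1 : A)) := by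
    rw [u.mul_sep_right hp, mul_assoc, Algebra.TensorProduct.tmul_mul_tmul, one_mul]
  rw [this, twist_apply]
  simp [sep, Finset.mul_sum, Finset.sum_mul]

/-- Any solution `X` of `(x ⊗ 1) X = X (1 ⊗ x)` is a multiple of the separability element. -/
theorem eq_sep_mul {X : A ⊗[ℂ] A} (hX : ∀ x ∈ N, (x ⊗ₜ[ℂ] 1) * X = X * ((1 : A) ⊗ₜ[ℂ] x))
    {ι : Type*} [Fintype ι] {a b : ι → A} (hab : X = ∑ i, a i ⊗ₜ[ℂ] b i) (hb : ∀ i, b i ∈ N) :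
    X = u.sep * ((∑ i, b i * a i) ⊗ₜ[ℂ] 1) := by
  -- By the intertwining property the left factors of the twist pass to the right of X, where they
  -- combine to ∑ (1/n) e_ij e_ji = 1. Expanding the twist on elementary tensors instead produces
  -- the multiple of the separability element.
  have h1 : u.twist X = X := by
    have h2 : ∀ γ i j, (u.e γ i j ⊗ₜ[ℂ] (1 : A)) * (X * ((1 : A) ⊗ₜ[ℂ] u.e γ j i)) =
        X * ((1 : A) ⊗ₜ[ℂ] (u.e γ i j * u.e γ j i)) := fun γ i j => by
      rw [← mul_assoc, hX _ (u.e_mem γ i j), mul_assoc, Algebra.TensorProduct.tmul_mul_tmul,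
        one_mul]
    simp only [twist_apply, h2, ← mul_smul_comm _ X, ← Finset.mul_sum, ← TensorProduct.tmul_smul,
      ← TensorProduct.tmul_sum]
    rw [u.sum_e_mul_e, ← Algebra.TensorProduct.one_def, mul_one]
  conv_lhs => rw [← h1, hab, map_sum]
  simp_rw [u.twist_tmul _ (hb _)]
  rw [TensorProduct.sum_tmul, Finset.mul_sum]

/-- The basis of a semisimple algebra given by a system of matrix units. -/
def basis {S : Subalgebra ℂ A} (u : MatrixUnits (S : Set A)) :
    Module.Basis ((γ : Fin u.r) × (Fin (u.n γ) × Fin (u.n γ))) ℂ S :=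
  Module.Basis.mk (v := fun t => ⟨u.e t.1 t.2.1 t.2.2, u.e_mem _ _ _⟩)
    (LinearIndependent.of_comp S.val.toLinearMap u.linInd) (by
      rintro ⟨x, hx⟩ -
      have h := u.span_eq.superset hx
      rw [SetLike.mem_coe] at h
      have h2 : (Submodule.span ℂ (Set.range fun t :
          (γ : Fin u.r) × (Fin (u.n γ) × Fin (u.n γ)) =>
            (⟨u.e t.1 t.2.1 t.2.2, u.e_mem _ _ _⟩ : S))).map S.val.toLinearMap =
          Submodule.span ℂ (Set.range fun t :
            (γ : Fin u.r) × (Fin (u.n γ) × Fin (u.n γ)) => u.e t.1 t.2.1 t.2.2) := by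
        rw [← Submodule.span_image, ← Set.range_comp]
        rfl
      rw [← h2] at h
      obtain ⟨y, hy, hyx⟩ := h
      have : y = ⟨x, hx⟩ := Subtype.ext hyx
      exact this ▸ hy)

theorem basis_apply {S : Subalgebra ℂ A} (u : MatrixUnits (S : Set A))
    (t : (γ : Fin u.r) × (Fin (u.n γ) × Fin (u.n γ))) :
    u.basis t = ⟨u.e t.1 t.2.1 t.2.2, u.e_mem _ _ _⟩ := by
  simp [basis]

theorem basis_mul_same {S : Subalgebra ℂ A} (u : MatrixUnits (S : Set A))
    (γ : Fin u.r) (i j k l : Fin (u.n γ)) :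
    u.basis ⟨γ, i, j⟩ * u.basis ⟨γ, k, l⟩ = if j = k then u.basis ⟨γ, i, l⟩ else 0 := by
  simp only [basis_apply]
  split_ifs with h
  · exact Subtype.ext (by simpa [h] using u.mul_same γ i j k l)
  · exact Subtype.ext (by simpa [h] using u.mul_same γ i j k l)

theorem basis_mul_ne {S : Subalgebra ℂ A} (u : MatrixUnits (S : Set A))
    {γ γ' : Fin u.r} (h : γ ≠ γ') (i j k l) :
    u.basis ⟨γ, i, j⟩ * u.basis ⟨γ', k, l⟩ = 0 := by
  simp only [basis_apply]
  exact Subtype.ext (u.mul_ne γ γ' h i j k l)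

/-- A functional on a semisimple algebra is the regular trace if it is so on matrix units. -/
theorem eq_trace_mulLeft {S : Subalgebra ℂ A}
    (u : MatrixUnits (S : Set A)) (φ : S →ₗ[ℂ] ℂ)
    (hφ : ∀ γ i j, φ (u.basis ⟨γ, i, j⟩) = if i = j then (u.n γ : ℂ) else 0) (x : S) :
    φ x = LinearMap.trace ℂ S (LinearMap.mulLeft ℂ x) := by
  suffices h : φ = LinearMap.trace ℂ S ∘ₗ LinearMap.mul ℂ S from LinearMap.congr_fun h x
  refine u.basis.ext fun ⟨δ, k, l⟩ => ?_
  rw [hφ, LinearMap.comp_apply, LinearMap.trace_eq_matrix_trace ℂ u.basis, Matrix.trace]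
  simp only [Matrix.diag_apply, LinearMap.toMatrix_apply, LinearMap.mul_apply']
  -- Only basis vectors e_lj of the block δ survive: e_kl e_lj = e_kj has a diagonal coefficient
  -- exactly when k = l, and then each of the n values of j contributes 1.
  rw [Fintype.sum_sigma, Finset.sum_eq_single δ]
  · rw [Fintype.sum_prod_type]
    simp only [basis_mul_same]
    rw [Finset.sum_eq_single l]
    · by_cases hkl : k = l
      · simp [hkl]
      · simp [hkl]
    · intro i _ hi
      simp [hi.symm]
    · simp
  · intro γ _ hγ
    simp [u.basis_mul_ne hγ.symm]
  · simp

end MatrixUnits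

/-! ### Slices of tensors and flipped multiplication -/

section TensorSlices

variable {A : Type*} [Ring A] [Algebra ℂ A]

/-- The right slice map `x ⊗ y ↦ φ(y) x`. -/
def sliceRight (φ : A →ₗ[ℂ] ℂ) : A ⊗[ℂ] A →ₗ[ℂ] A :=
  TensorProduct.rid ℂ A ∘ₗ TensorProduct.map LinearMap.id φ

/-- The left slice map `x ⊗ y ↦ φ(x) y`. -/
def sliceLeft (φ : A →ₗ[ℂ] ℂ) : A ⊗[ℂ] A →ₗ[ℂ] A :=
  TensorProduct.lid ℂ A ∘ₗ TensorProduct.map φ LinearMap.id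

@[simp]
theorem sliceRight_tmul (φ : A →ₗ[ℂ] ℂ) (x y : A) : sliceRight φ (x ⊗ₜ[ℂ] y) = φ y • x := by
  simp [sliceRight]

@[simp]
theorem sliceLeft_tmul (φ : A →ₗ[ℂ] ℂ) (x y : A) : sliceLeft φ (x ⊗ₜ[ℂ] y) = φ x • y := by
  simp [sliceLeft]

theorem sliceRight_map (φ : A →ₗ[ℂ] ℂ) (f g : A →ₗ[ℂ] A) (z : A ⊗[ℂ] A) :
    sliceRight φ (TensorProduct.map f g z) = f (sliceRight (φ ∘ₗ g) z) := by
  induction z with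
  | zero => simp
  | tmul a b => simp
  | add z w hz hw => simp only [map_add, hz, hw]

theorem sliceLeft_map (φ : A →ₗ[ℂ] ℂ) (f g : A →ₗ[ℂ] A) (z : A ⊗[ℂ] A) :
    sliceLeft φ (TensorProduct.map f g z) = g (sliceLeft (φ ∘ₗ f) z) := by
  induction z with
  | zero => simp
  | tmul a b => simp
  | add z w hz hw => simp only [map_add, hz, hw]

theorem sliceLeft_comm (φ : A →ₗ[ℂ] ℂ) (z : A ⊗[ℂ] A) :
    sliceLeft φ (TensorProduct.comm ℂ A A z) = sliceRight φ z := by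
  induction z with
  | zero => simp
  | tmul a b => simp
  | add z w hz hw => simp only [map_add, hz, hw]

theorem sliceRight_tmul_one_mul (φ : A →ₗ[ℂ] ℂ) (x : A) (z : A ⊗[ℂ] A) :
    sliceRight φ ((x ⊗ₜ[ℂ] 1) * z) = x * sliceRight φ z := by
  induction z with
  | zero => simp
  | tmul a b => simp
  | add z w hz hw => simp only [mul_add, map_add, hz, hw]

theorem sliceRight_mul_tmul_one (φ : A →ₗ[ℂ] ℂ) (x : A) (z : A ⊗[ℂ] A) :
    sliceRight φ (z * (x ⊗ₜ[ℂ] 1)) = sliceRight φ z * x := by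
  induction z with
  | zero => simp
  | tmul a b => simp
  | add z w hz hw => simp only [add_mul, map_add, hz, hw]

theorem sliceRight_one_tmul_mul (φ : A →ₗ[ℂ] ℂ) (x : A) (z : A ⊗[ℂ] A) :
    sliceRight φ ((1 ⊗ₜ[ℂ] x) * z) = sliceRight (φ ∘ₗ LinearMap.mulLeft ℂ x) z := by
  induction z with
  | zero => simp
  | tmul a b => simp
  | add z w hz hw => simp only [mul_add, map_add, hz, hw]

theorem sliceLeft_mul_tmul_one (φ : A →ₗ[ℂ] ℂ) (x : A) (z : A ⊗[ℂ] A) :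
    sliceLeft φ (z * (x ⊗ₜ[ℂ] 1)) = sliceLeft (φ ∘ₗ LinearMap.mulRight ℂ x) z := by
  induction z with
  | zero => simp
  | tmul a b => simp
  | add z w hz hw => simp only [add_mul, map_add, hz, hw]

theorem sum_sliceRight_tmul {ι : Type*} [Fintype ι] (b : Module.Basis ι ℂ A) (z : A ⊗[ℂ] A) :
    z = ∑ i, sliceRight (b.coord i) z ⊗ₜ[ℂ] b i := by
  induction z with
  | zero => simp
  | tmul x y =>
    simp only [sliceRight_tmul, TensorProduct.smul_tmul, Module.Basis.coord_apply]
    rw [← TensorProduct.tmul_sum, b.sum_repr]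
  | add z w hz hw =>
    conv_lhs => rw [hz, hw]
    simp only [map_add, TensorProduct.add_tmul, Finset.sum_add_distrib]

theorem sum_tmul_sliceLeft {ι : Type*} [Fintype ι] (b : Module.Basis ι ℂ A) (z : A ⊗[ℂ] A) :
    z = ∑ i, b i ⊗ₜ[ℂ] sliceLeft (b.coord i) z := by
  induction z with
  | zero => simp
  | tmul x y =>
    simp only [sliceLeft_tmul, ← TensorProduct.smul_tmul, Module.Basis.coord_apply]
    rw [← TensorProduct.sum_tmul, b.sum_repr]
  | add z w hz hw =>
    conv_lhs => rw [hz, hw]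
    simp only [map_add, TensorProduct.tmul_add, Finset.sum_add_distrib]

/-- A tensor whose slices are in `P` and in `Q` is in `P ⊗ Q`. -/
theorem exists_eq_sum_tmul_of_slices [FiniteDimensional ℂ A] (P Q : Submodule ℂ A)
    {z : A ⊗[ℂ] A} (hP : ∀ φ, sliceRight φ z ∈ P) (hQ : ∀ φ, sliceLeft φ z ∈ Q) :
    ∃ (n : ℕ) (a b : Fin n → A), (∀ i, a i ∈ P) ∧ (∀ i, b i ∈ Q) ∧ z = ∑ i, a i ⊗ₜ[ℂ] b i := by
  let v := Module.finBasis ℂ A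
  -- A linear projection ρ onto Q fixes the second legs of z because all left slices lie in Q.
  -- Expanding in a basis and then projecting puts both legs where they belong at once.
  obtain ⟨ρ, hρ⟩ := Q.subtype.exists_leftInverse_of_injective Q.ker_subtype
  have h1 : TensorProduct.map LinearMap.id (Q.subtype ∘ₗ ρ) z = z := by
    have h2 : ∀ y ∈ Q, (ρ y : A) = y := fun y hy =>
      congrArg Subtype.val (LinearMap.congr_fun hρ ⟨y, hy⟩)
    have hz := sum_tmul_sliceLeft v z
    conv_rhs => rw [hz]
    conv_lhs => rw [hz]
    rw [map_sum]
    refine Finset.sum_congr rfl fun i _ => ?_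
    rw [TensorProduct.map_tmul, LinearMap.id_apply, LinearMap.comp_apply, Submodule.subtype_apply,
      h2 _ (hQ _)]
  refine ⟨_, fun i => sliceRight (v.coord i) z, fun i => ρ (v i), fun i => hP _,
    fun i => (ρ (v i)).2, ?_⟩
  conv_lhs => rw [← h1, sum_sliceRight_tmul v z]
  simp

/-- The opposite multiplication `a ⊗ b ↦ b * a`. -/
def opMul : A ⊗[ℂ] A →ₗ[ℂ] A := LinearMap.mul' ℂ A ∘ₗ (TensorProduct.comm ℂ A A).toLinearMap

@[simp]
theorem opMul_tmul (a b : A) : opMul (a ⊗ₜ[ℂ] b) = b * a := by simp [opMul]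

theorem opMul_one_tmul_mul (x : A) (z : A ⊗[ℂ] A) :
    opMul ((1 ⊗ₜ[ℂ] x) * z) = x * opMul z := by
  induction z with
  | zero => simp
  | tmul a b => simp [mul_assoc]
  | add z w hz hw => simp only [mul_add, map_add, hz, hw]

theorem opMul_mul_tmul_one (x : A) (z : A ⊗[ℂ] A) :
    opMul (z * (x ⊗ₜ[ℂ] 1)) = opMul z * x := by
  induction z with
  | zero => simp
  | tmul a b => simp [mul_assoc]
  | add z w hz hw => simp only [add_mul, map_add, hz, hw]

theorem MatrixUnits.opMul_sep {N : Set A} (u : MatrixUnits N) : opMul u.sep = 1 := by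
  have h1 : opMul u.sep = LinearMap.mul' ℂ A (TensorProduct.comm ℂ A A u.sep) := rfl
  rw [h1, u.comm_sep, ← u.sandwich_one_sep]
  congr 1
  ext a b
  simp

end TensorSlices

/-! ### Antipode, counit and the legs of Δ(1) in the Cartan subalgebras -/

namespace QuantumGroupoidData

variable {A : Type*} [Ring A] [Algebra ℂ A] {G : QuantumGroupoidData A}

@[simp]
theorem tensorStar_tmul (x y : A) : G.tensorStar (x ⊗ₜ[ℂ] y) = G.star x ⊗ₜ[ℂ] G.star y := by
  simp [tensorStar]

/-- The linear map `x ⊗ y ↦ κ(y) ⊗ κ(x)`. -/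
def tensorAntipode (G : QuantumGroupoidData A) : A ⊗[ℂ] A →ₗ[ℂ] A ⊗[ℂ] A :=
  (TensorProduct.comm ℂ A A).toLinearMap ∘ₗ TensorProduct.map G.antipode G.antipode

@[simp]
theorem tensorAntipode_tmul (x y : A) :
    G.tensorAntipode (x ⊗ₜ[ℂ] y) = G.antipode y ⊗ₜ[ℂ] G.antipode x := by
  simp [tensorAntipode]

/-- The linear map `x ⊗ y ↦ κ(x) * y`. -/
def antipodeMul (G : QuantumGroupoidData A) : A ⊗[ℂ] A →ₗ[ℂ] A :=
  LinearMap.mul' ℂ A ∘ₗ TensorProduct.map G.antipode LinearMap.id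

@[simp]
theorem antipodeMul_tmul (x y : A) : G.antipodeMul (x ⊗ₜ[ℂ] y) = G.antipode x * y := by
  simp [antipodeMul]

/-- The element `∑ y * κ(x)` of `A`, where `Δ(1) = ∑ x ⊗ y`. -/
def canonicalElement (G : QuantumGroupoidData A) : A :=
  opMul (TensorProduct.map G.antipode LinearMap.id (G.comul 1))

namespace IsCStarQuantumGroupoid

variable (h : G.IsCStarQuantumGroupoid)
include h

theorem star_one : G.star 1 = 1 := h.cstar.map_one

theorem star_antipode_star_antipode (x : A) : G.star (G.antipode (G.star (G.antipode x))) = x := by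
  have h1 := congrArg G.star (h.antipode_star (G.star x))
  rwa [h.cstar.invol] at h1

theorem antipode_injective : Function.Injective G.antipode := fun x y hxy => by
  rw [← h.star_antipode_star_antipode x, ← h.star_antipode_star_antipode y, hxy]

theorem antipode_one : G.antipode 1 = 1 := by
  obtain ⟨y, hy⟩ : ∃ y, G.antipode y = 1 := ⟨_, h.antipode_star 1⟩
  have h1 := h.antipode_mul 1 y
  rwa [one_mul, hy, one_mul, eq_comm] at h1

theorem tensorStar_mul (z w : A ⊗[ℂ] A) :
    G.tensorStar (z * w) = G.tensorStar w * G.tensorStar z := by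
  induction z with
  | zero => simp
  | tmul a b =>
    induction w with
    | zero => simp
    | tmul c d => simp [h.cstar.antimul]
    | add z w hz hw => simp only [mul_add, add_mul, map_add, hz, hw]
  | add z w hz hw => simp only [mul_add, add_mul, map_add, hz, hw]

theorem tensorStar_comul_one : G.tensorStar (G.comul 1) = G.comul 1 := by
  rw [← h.comul_star, h.star_one]

theorem tensorAntipode_mul (z w : A ⊗[ℂ] A) :
    G.tensorAntipode (z * w) = G.tensorAntipode w * G.tensorAntipode z := by
  induction z with
  | zero => simp
  | tmul a b =>
    induction w with
    | zero => simp
    | tmul c d => simp [h.antipode_mul]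
    | add z w hz hw => simp only [mul_add, add_mul, map_add, hz, hw]
  | add z w hz hw => simp only [mul_add, add_mul, map_add, hz, hw]

theorem comul_antipode (x : A) : G.comul (G.antipode x) = G.tensorAntipode (G.comul x) := by
  rw [tensorAntipode, LinearMap.comp_apply, h.antipode_comul]
  exact ((TensorProduct.comm ℂ A A).symm_apply_apply _).symm

theorem tensorAntipode_comul_one : G.tensorAntipode (G.comul 1) = G.comul 1 := by
  rw [← h.comul_antipode, h.antipode_one]

theorem comul_one_mul (x : A) : G.comul 1 * G.comul x = G.comul x := by
  rw [← h.comul_mul, one_mul]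

theorem comul_mul_one (x : A) : G.comul x * G.comul 1 = G.comul x := by
  rw [← h.comul_mul, mul_one]

theorem sliceLeft_counit (x : A) : sliceLeft G.counit (G.comul x) = x := h.counit_left x

theorem sliceRight_counit (x : A) : sliceRight G.counit (G.comul x) = x := h.counit_right x

/-- By (κ ⊗ κ)Δ = ςΔκ and injectivity of κ, the form ε ∘ κ is also a left counit. Applying ε to the
remaining leg and using the right counit property of ε identifies the two. -/
theorem counit_antipode (x : A) : G.counit (G.antipode x) = G.counit x := by
  have key : sliceLeft (G.counit ∘ₗ G.antipode) (G.comul x) = x := by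
    apply h.antipode_injective
    rw [← sliceLeft_map, h.antipode_comul, sliceLeft_comm, h.sliceRight_counit]
  have h2 : ∀ z : A ⊗[ℂ] A, G.counit (sliceLeft (G.counit ∘ₗ G.antipode) z) =
      G.counit (G.antipode (sliceRight G.counit z)) := by
    intro z
    induction z with
    | zero => simp
    | tmul a b => simp [mul_comm]
    | add z w hz hw => simp only [map_add, hz, hw]
  rw [← congrArg G.counit key, h2, h.sliceRight_counit]

theorem antipodeMul_comul_mul (x : A) :
    TensorProduct.map (G.antipodeMul ∘ₗ G.comul) LinearMap.id (G.comul x) =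
      (1 ⊗ₜ[ℂ] x) * G.comul 1 := by
  rw [← antipode_axiom h x]
  change _ = TensorProduct.map G.antipodeMul LinearMap.id _
  generalize G.comul x = z
  induction z with
  | zero => simp
  | tmul a b => simp
  | add z w hz hw => simp only [map_add, hz, hw]

/-- `Δ(κ(x₁) x₂) = (1 ⊗ κ(x₁) x₂) Δ(1)`. -/
theorem comul_antipodeMul_comul (x : A) : G.comul (G.antipodeMul (G.comul x)) =
    (1 ⊗ₜ[ℂ] G.antipodeMul (G.comul x)) * G.comul 1 := by
  let μ : (A ⊗[ℂ] A) ⊗[ℂ] (A ⊗[ℂ] A) →ₗ[ℂ] A ⊗[ℂ] A :=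
    LinearMap.mul' ℂ (A ⊗[ℂ] A) ∘ₗ TensorProduct.map G.tensorAntipode LinearMap.id
  have hμ : ∀ p r, μ (p ⊗ₜ[ℂ] r) = G.tensorAntipode p * r := fun p r => by simp [μ]
  let L : (A ⊗[ℂ] A) ⊗[ℂ] A →ₗ[ℂ] A ⊗[ℂ] A := μ ∘ₗ TensorProduct.map LinearMap.id G.comul
  have hL : ∀ p c, L (p ⊗ₜ[ℂ] c) = G.tensorAntipode p * G.comul c := fun p c => by simp [L, hμ]
  have step1 : ∀ z, G.comul (G.antipodeMul z) = L (TensorProduct.map G.comul LinearMap.id z) := by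
    intro z
    induction z with
    | zero => simp
    | tmul a b => simp [hL, h.comul_mul, h.comul_antipode]
    | add z w hz hw => simp only [map_add, hz, hw]
  -- Here L gives (κ(b₁) ⊗ κ(a))Δ(b₂). Coassociativity regroups it as (1 ⊗ κ(a)) times the left side
  -- of the antipode axiom for b.
  have step2 : ∀ a b, L ((TensorProduct.assoc ℂ A A A).symm (a ⊗ₜ[ℂ] G.comul b)) =
      (1 ⊗ₜ[ℂ] (G.antipode a * b)) * G.comul 1 := by
    intro a b
    let R : A ⊗[ℂ] (A ⊗[ℂ] A) →ₗ[ℂ] A ⊗[ℂ] A :=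
      μ ∘ₗ TensorProduct.map (TensorProduct.mk ℂ A A a) LinearMap.id
    have hR : ∀ c r, R (c ⊗ₜ[ℂ] r) = G.tensorAntipode (a ⊗ₜ[ℂ] c) * r := fun c r => by
      simp [R, hμ]
    have e1 : ∀ w, L ((TensorProduct.assoc ℂ A A A).symm (a ⊗ₜ[ℂ] w)) =
        R (TensorProduct.map LinearMap.id G.comul w) := by
      intro w
      induction w with
      | zero => simp
      | tmul c d => simp [hL, hR]
      | add z w hz hw => simp only [TensorProduct.tmul_add, map_add, hz, hw]
    have e2 : ∀ v, R (TensorProduct.assoc ℂ A A A v) =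
        (1 ⊗ₜ[ℂ] G.antipode a) * TensorProduct.map G.antipodeMul LinearMap.id v := by
      intro v
      induction v with
      | zero => simp
      | tmul p d =>
        induction p with
        | zero => simp
        | tmul b c => simp [hR]
        | add z w hz hw => simp only [TensorProduct.add_tmul, map_add, hz, hw, mul_add]
      | add z w hz hw => simp only [map_add, hz, hw, mul_add]
    rw [e1, ← h.coassoc, e2]
    have := antipode_axiom h b
    change TensorProduct.map G.antipodeMul LinearMap.id _ = _ at this
    rw [this, ← mul_assoc, Algebra.TensorProduct.tmul_mul_tmul, one_mul]
  have step3 : ∀ z, L ((TensorProduct.assoc ℂ A A A).symm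
      (TensorProduct.map LinearMap.id G.comul z)) =
        (1 ⊗ₜ[ℂ] G.antipodeMul z) * G.comul 1 := by
    intro z
    induction z with
    | zero => simp
    | tmul a b => simp [step2]
    | add z w hz hw => simp only [TensorProduct.tmul_add, map_add, hz, hw, add_mul]
  rw [step1, ← step3, ← h.coassoc, LinearEquiv.symm_apply_apply]

/-- The antipode axiom at 1 shows that the first legs of Δ(1) are fixed by a ↦ κ(a₁)a₂, so the
coproduct formula for such elements applies to them. -/
theorem sliceRight_comul_one_eq (φ : A →ₗ[ℂ] ℂ) :
    G.antipodeMul (G.comul (sliceRight φ (G.comul 1))) = sliceRight φ (G.comul 1) := by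
  have h1 := congrArg (sliceRight φ) (h.antipodeMul_comul_mul 1)
  rwa [sliceRight_map, ← Algebra.TensorProduct.one_def, one_mul, LinearMap.comp_id] at h1

theorem comul_sliceRight_comul_one (φ : A →ₗ[ℂ] ℂ) : G.comul (sliceRight φ (G.comul 1)) =
    (1 ⊗ₜ[ℂ] sliceRight φ (G.comul 1)) * G.comul 1 := by
  rw [← h.sliceRight_comul_one_eq φ]
  exact h.comul_antipodeMul_comul _

theorem star_sliceRight (φ : A →ₗ[ℂ] ℂ) : ∃ ψ : A →ₗ[ℂ] ℂ, ∀ z,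
    G.star (sliceRight φ z) = sliceRight ψ (G.tensorStar z) := by
  let ψ : A →ₗ[ℂ] ℂ :=
    { toFun := fun x => conj (φ (G.star x))
      map_add' := fun x y => by simp
      map_smul' := fun c x => by simp }
  refine ⟨ψ, fun z => ?_⟩
  induction z with
  | zero => simp
  | tmul a b => simp [ψ, h.cstar.invol]
  | add z w hz hw => simp only [map_add, hz, hw]

/-- One of the two identities is `comul_sliceRight_comul_one`. The other is its adjoint: Δ(1) is
self-adjoint, and the adjoint of a slice of Δ(1) is again one. -/
theorem sliceRight_mem_source (φ : A →ₗ[ℂ] ℂ) : sliceRight φ (G.comul 1) ∈ G.source := by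
  refine ⟨?_, h.comul_sliceRight_comul_one φ⟩
  obtain ⟨ψ, hψ⟩ := h.star_sliceRight φ
  have h1 := h.comul_sliceRight_comul_one ψ
  have h2 := hψ (G.comul 1)
  rw [h.tensorStar_comul_one] at h2
  rw [← h2, h.comul_star] at h1
  have h3 := congrArg G.tensorStar h1
  have hinv : ∀ z, G.tensorStar (G.tensorStar z) = z := by
    intro z
    induction z with
    | zero => simp
    | tmul a b => simp [h.cstar.invol]
    | add z w hz hw => simp only [map_add, hz, hw]
  rwa [h.tensorStar_mul, hinv, h.tensorStar_comul_one, tensorStar_tmul, h.star_one,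
    h.cstar.invol] at h3

theorem antipode_mem_source {x : A} (hx : x ∈ G.target) : G.antipode x ∈ G.source := by
  constructor
  · rw [h.comul_antipode, hx.2, h.tensorAntipode_mul, h.tensorAntipode_comul_one,
      tensorAntipode_tmul, h.antipode_one]
  · rw [h.comul_antipode, hx.1, h.tensorAntipode_mul, h.tensorAntipode_comul_one,
      tensorAntipode_tmul, h.antipode_one]

theorem antipode_mem_target {x : A} (hx : x ∈ G.source) : G.antipode x ∈ G.target := by
  constructor
  · rw [h.comul_antipode, hx.2, h.tensorAntipode_mul, h.tensorAntipode_comul_one,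
      tensorAntipode_tmul, h.antipode_one]
  · rw [h.comul_antipode, hx.1, h.tensorAntipode_mul, h.tensorAntipode_comul_one,
      tensorAntipode_tmul, h.antipode_one]

theorem star_mem_target {x : A} (hx : x ∈ G.target) : G.star x ∈ G.target := by
  constructor
  · rw [h.comul_star, hx.2, h.tensorStar_mul, h.tensorStar_comul_one, tensorStar_tmul, h.star_one]
  · rw [h.comul_star, hx.1, h.tensorStar_mul, h.tensorStar_comul_one, tensorStar_tmul, h.star_one]

theorem star_mem_source {x : A} (hx : x ∈ G.source) : G.star x ∈ G.source := by
  constructor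
  · rw [h.comul_star, hx.2, h.tensorStar_mul, h.tensorStar_comul_one, tensorStar_tmul, h.star_one]
  · rw [h.comul_star, hx.1, h.tensorStar_mul, h.tensorStar_comul_one, tensorStar_tmul, h.star_one]

theorem exists_source_antipode_eq {x : A} (hx : x ∈ G.target) :
    ∃ y ∈ G.source, G.antipode y = x :=
  ⟨_, h.star_mem_source (h.antipode_mem_source (h.star_mem_target hx)), h.antipode_star x⟩

theorem exists_target_antipode_eq {x : A} (hx : x ∈ G.source) :
    ∃ y ∈ G.target, G.antipode y = x :=
  ⟨_, h.star_mem_target (h.antipode_mem_target (h.star_mem_source hx)), h.antipode_star x⟩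

/-- Invariance of Δ(1) under κ ⊗ κ followed by the flip makes κ of a left slice a right slice; κ is
injective and maps A_t onto A_s. -/
theorem sliceLeft_mem_target (φ : A →ₗ[ℂ] ℂ) : sliceLeft φ (G.comul 1) ∈ G.target := by
  let κ : A ≃ₗ[ℂ] A := LinearEquiv.ofBijective G.antipode
    ⟨h.antipode_injective, fun x => ⟨_, h.antipode_star x⟩⟩
  have hκ : (φ ∘ₗ κ.symm.toLinearMap) ∘ₗ G.antipode = φ := by
    ext x
    exact congrArg φ (κ.symm_apply_apply x)
  have h1 : G.antipode (sliceLeft φ (G.comul 1)) ∈ G.source := by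
    have h2 := sliceLeft_map (φ ∘ₗ κ.symm.toLinearMap) G.antipode G.antipode (G.comul 1)
    rw [hκ, h.antipode_comul, h.antipode_one, sliceLeft_comm] at h2
    rw [← h2]
    exact h.sliceRight_mem_source _
  obtain ⟨y, hy, hyx⟩ := h.exists_target_antipode_eq h1
  rwa [← h.antipode_injective hyx]

theorem mul_mem_target {x y : A} (hx : x ∈ G.target) (hy : y ∈ G.target) :
    x * y ∈ G.target := by
  constructor
  · rw [h.comul_mul, hy.1, ← mul_assoc, h.comul_mul_one, hx.1, mul_assoc]
    simp
  · rw [h.comul_mul, hx.2, mul_assoc, h.comul_one_mul, hy.2, ← mul_assoc]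
    simp

theorem mul_mem_source {x y : A} (hx : x ∈ G.source) (hy : y ∈ G.source) :
    x * y ∈ G.source := by
  constructor
  · rw [h.comul_mul, hy.1, ← mul_assoc, h.comul_mul_one, hx.1, mul_assoc]
    simp
  · rw [h.comul_mul, hx.2, mul_assoc, h.comul_one_mul, hy.2, ← mul_assoc]
    simp

/-- The target Cartan subalgebra as a subalgebra. -/
def targetSubalgebra : Subalgebra ℂ A where
  carrier := G.target
  mul_mem' := h.mul_mem_target
  add_mem' {x y} hx hy := ⟨by rw [map_add, hx.1, hy.1, TensorProduct.add_tmul, mul_add],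
    by rw [map_add, hx.2, hy.2, TensorProduct.add_tmul, add_mul]⟩
  algebraMap_mem' c := by
    simp only [target, Set.mem_ofPred_eq, Algebra.algebraMap_eq_smul_one, map_smul,
      ← TensorProduct.smul_tmul', mul_smul_comm, smul_mul_assoc]
    simp [← Algebra.TensorProduct.one_def]

/-- The source Cartan subalgebra as a subalgebra. -/
def sourceSubalgebra : Subalgebra ℂ A where
  carrier := G.source
  mul_mem' := h.mul_mem_source
  add_mem' {x y} hx hy := ⟨by rw [map_add, hx.1, hy.1, TensorProduct.tmul_add, mul_add],
    by rw [map_add, hx.2, hy.2, TensorProduct.tmul_add, add_mul]⟩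
  algebraMap_mem' c := by
    simp only [source, Set.mem_ofPred_eq, Algebra.algebraMap_eq_smul_one, map_smul,
      TensorProduct.tmul_smul, mul_smul_comm, smul_mul_assoc]
    simp [← Algebra.TensorProduct.one_def]

theorem inv_mem_target {k : Aˣ} (hk : (k : A) ∈ G.target) : (↑k⁻¹ : A) ∈ G.target := by
  have e1 : ((↑k⁻¹ : A) ⊗ₜ[ℂ] (1 : A)) * ((k : A) ⊗ₜ[ℂ] (1 : A)) = 1 := by
    simp [← Algebra.TensorProduct.one_def]
  have e2 : ((k : A) ⊗ₜ[ℂ] (1 : A)) * ((↑k⁻¹ : A) ⊗ₜ[ℂ] (1 : A)) = 1 := by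
    simp [← Algebra.TensorProduct.one_def]
  constructor
  · have h1 : G.comul (↑k⁻¹ : A) * G.comul k = G.comul 1 := by
      rw [← h.comul_mul, Units.inv_mul]
    rw [hk.1, ← mul_assoc, h.comul_mul_one] at h1
    rw [← h1, mul_assoc, e2, mul_one]
  · have h1 : G.comul k * G.comul (↑k⁻¹ : A) = G.comul 1 := by
      rw [← h.comul_mul, Units.mul_inv]
    rw [hk.2, mul_assoc, h.comul_one_mul] at h1
    rw [← h1, ← mul_assoc, e1, one_mul]

/-- Since x ⊗ 1 and 1 ⊗ y commute, xy and yx have the same coproduct, and the counit recovers an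
element from its coproduct. -/
theorem commute_target_source {x y : A} (hx : x ∈ G.target) (hy : y ∈ G.source) :
    Commute x y := by
  have h1 : G.comul (x * y) = G.comul (y * x) := by
    have e1 : G.comul x * G.comul y = (x ⊗ₜ[ℂ] 1) * ((1 ⊗ₜ[ℂ] y) * G.comul 1) := by
      rw [hx.2, mul_assoc, h.comul_one_mul, hy.2]
    have e2 : G.comul y * G.comul x = (1 ⊗ₜ[ℂ] y) * ((x ⊗ₜ[ℂ] 1) * G.comul 1) := by
      rw [hy.2, mul_assoc, h.comul_one_mul, hx.2]
    rw [h.comul_mul, h.comul_mul, e1, e2, ← mul_assoc, ← mul_assoc]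
    simp
  have h2 := congrArg (sliceLeft G.counit) h1
  rwa [h.sliceLeft_counit, h.sliceLeft_counit] at h2

theorem exists_comul_one_eq_sum : ∃ (n : ℕ) (a b : Fin n → A), (∀ i, a i ∈ G.source) ∧
    (∀ i, b i ∈ G.target) ∧ G.comul 1 = ∑ i, a i ⊗ₜ[ℂ] b i :=
  have := h.finite
  exists_eq_sum_tmul_of_slices (Subalgebra.toSubmodule h.sourceSubalgebra)
    (Subalgebra.toSubmodule h.targetSubalgebra) h.sliceRight_mem_source h.sliceLeft_mem_target

end IsCStarQuantumGroupoid
end QuantumGroupoidData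

/-! ### The canonical element -/

namespace QuantumGroupoidData

variable {A : Type*} [Ring A] [Algebra ℂ A] {G : QuantumGroupoidData A}

namespace IsCStarQuantumGroupoid

open MatrixUnits

variable (h : G.IsCStarQuantumGroupoid)
include h

theorem antipodeMul_comul_mul_target (a : A) {x : A} (hx : x ∈ G.target) :
    G.antipodeMul (G.comul (a * x)) = G.antipode x * G.antipodeMul (G.comul a) := by
  have h1 : G.comul (a * x) = G.comul a * (x ⊗ₜ[ℂ] 1) := by
    rw [h.comul_mul, hx.1, ← mul_assoc, h.comul_mul_one]
  rw [h1]
  generalize G.comul a = z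
  induction z with
  | zero => simp
  | tmul a b => simp [h.antipode_mul, mul_assoc]
  | add z w hz hw => simp only [map_add, hz, hw, add_mul, mul_add]

/-- Both sides compute κ(x₁)x₂ ⊗ x₃: the antipode axiom gives the left side, and Δ(x) = Δ(1)(x ⊗ 1)
lets κ(x) be pulled out in front. -/
theorem one_tmul_mul_comul_one {x : A} (hx : x ∈ G.target) :
    (1 ⊗ₜ[ℂ] x) * G.comul 1 = (G.antipode x ⊗ₜ[ℂ] 1) * G.comul 1 := by
  have h1 : ∀ z : A ⊗[ℂ] A,
      TensorProduct.map (G.antipodeMul ∘ₗ G.comul) LinearMap.id (z * (x ⊗ₜ[ℂ] 1)) =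
        (G.antipode x ⊗ₜ[ℂ] 1) *
          TensorProduct.map (G.antipodeMul ∘ₗ G.comul) LinearMap.id z := by
    intro z
    induction z with
    | zero => simp
    | tmul a b => simp [h.antipodeMul_comul_mul_target a hx]
    | add z w hz hw => simp only [map_add, hz, hw, add_mul, mul_add]
  rw [← h.antipodeMul_comul_mul, hx.1, h1, h.antipodeMul_comul_mul,
    ← Algebra.TensorProduct.one_def, one_mul]

theorem comul_one_mul_tmul_one {x : A} (hx : x ∈ G.source) :
    G.comul 1 * (x ⊗ₜ[ℂ] 1) = G.comul 1 * (1 ⊗ₜ[ℂ] G.antipode x) := by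
  have h1 := congrArg G.tensorStar
    (h.one_tmul_mul_comul_one (h.star_mem_target (h.antipode_mem_target hx)))
  simp only [h.tensorStar_mul, h.tensorStar_comul_one, tensorStar_tmul, h.star_one,
    h.cstar.invol, h.star_antipode_star_antipode] at h1
  exact h1.symm

/-- The element `(κ ⊗ i)Δ(1)` intertwines `x ⊗ 1` and `1 ⊗ x` for `x` in `A_t`. -/
theorem tmul_one_mul_map_antipode {x : A} (hx : x ∈ G.target) :
    (x ⊗ₜ[ℂ] 1) * TensorProduct.map G.antipode LinearMap.id (G.comul 1) =
      TensorProduct.map G.antipode LinearMap.id (G.comul 1) * (1 ⊗ₜ[ℂ] x) := by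
  obtain ⟨z, hz, rfl⟩ := h.exists_source_antipode_eq hx
  have h1 : ∀ w : A ⊗[ℂ] A, TensorProduct.map G.antipode LinearMap.id (w * (z ⊗ₜ[ℂ] 1)) =
      (G.antipode z ⊗ₜ[ℂ] 1) * TensorProduct.map G.antipode LinearMap.id w := by
    intro w
    induction w with
    | zero => simp
    | tmul a b => simp [h.antipode_mul]
    | add z w hz hw => simp only [map_add, hz, hw, add_mul, mul_add]
  have h2 : ∀ (w : A ⊗[ℂ] A) (y : A),
      TensorProduct.map G.antipode LinearMap.id (w * (1 ⊗ₜ[ℂ] y)) =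
        TensorProduct.map G.antipode LinearMap.id w * (1 ⊗ₜ[ℂ] y) := by
    intro w y
    induction w with
    | zero => simp
    | tmul a b => simp
    | add z w hz hw => simp only [map_add, hz, hw, add_mul]
  rw [← h1, h.comul_one_mul_tmul_one hz, h2]

theorem canonicalElement_mem : G.canonicalElement ∈ G.target := by
  obtain ⟨n, a, b, ha, hb, hE⟩ := h.exists_comul_one_eq_sum
  rw [canonicalElement, hE]
  simp only [map_sum, TensorProduct.map_tmul, LinearMap.id_apply, opMul_tmul]
  exact Subalgebra.sum_mem h.targetSubalgebra fun i _ =>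
    h.mul_mem_target (hb i) (h.antipode_mem_target (ha i))

theorem map_antipode_comul_one (u : MatrixUnits G.target) :
    TensorProduct.map G.antipode LinearMap.id (G.comul 1) =
      u.sep * (G.canonicalElement ⊗ₜ[ℂ] 1) := by
  obtain ⟨n, a, b, ha, hb, hE⟩ := h.exists_comul_one_eq_sum
  have hF : TensorProduct.map G.antipode LinearMap.id (G.comul 1) =
      ∑ i, G.antipode (a i) ⊗ₜ[ℂ] b i := by
    simp [hE]
  have hq : G.canonicalElement = ∑ i, b i * G.antipode (a i) := by
    rw [canonicalElement, hF]
    simp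
  rw [hq]
  exact u.eq_sep_mul (fun x hx => h.tmul_one_mul_map_antipode hx) hF hb

theorem isCStarInvolution_target : IsCStarInvolution (IsCStarInvolution.restrict G.star
    h.targetSubalgebra fun _ => h.star_mem_target) :=
  h.cstar.restrict_isCStarInvolution _ _

theorem nonempty_matrixUnits : Nonempty (MatrixUnits G.target) := by
  have := h.finite
  have := h.isCStarInvolution_target.isSemisimpleRing
  exact MatrixUnits.nonempty_of_isSemisimpleRing h.targetSubalgebra

/-- The canonical element exists and is unique. -/
theorem isCanonical_iff (x : A) : G.IsCanonical x ↔ x = G.canonicalElement := by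
  have hsep : ∀ (u : MatrixUnits G.target) (x : A),
      (∑ γ, ∑ i, ∑ j, ((u.n γ : ℂ)⁻¹) • ((u.e γ i j * x) ⊗ₜ[ℂ] u.e γ j i)) =
        u.sep * (x ⊗ₜ[ℂ] 1) := by
    intro u x
    simp [sep, Finset.sum_mul]
  constructor
  · rintro ⟨-, hx⟩
    obtain ⟨u⟩ := h.nonempty_matrixUnits
    have h1 := hx u
    rw [hsep] at h1
    rw [canonicalElement, h1, opMul_mul_tmul_one, u.opMul_sep, one_mul]
  · rintro rfl
    exact ⟨h.canonicalElement_mem, fun u => by rw [hsep, h.map_antipode_comul_one u]⟩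

/-- Obtained from (1 ⊗ x)Δ(1) = (κ(x) ⊗ 1)Δ(1) by κ ⊗ i and flipped multiplication. With q
invertible, it makes κ² inner on A_t. -/
theorem canonicalElement_mul_antipode_antipode {x : A} (hx : x ∈ G.target) :
    G.canonicalElement * G.antipode (G.antipode x) = x * G.canonicalElement := by
  have h1 : ∀ w : A ⊗[ℂ] A,
      TensorProduct.map G.antipode LinearMap.id ((G.antipode x ⊗ₜ[ℂ] 1) * w) =
        TensorProduct.map G.antipode LinearMap.id w *
          (G.antipode (G.antipode x) ⊗ₜ[ℂ] 1) := by
    intro w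
    induction w with
    | zero => simp
    | tmul a b => simp [h.antipode_mul]
    | add z w hz hw => simp only [map_add, hz, hw, add_mul, mul_add]
  have h2 : ∀ w : A ⊗[ℂ] A,
      TensorProduct.map G.antipode LinearMap.id ((1 ⊗ₜ[ℂ] x) * w) =
        (1 ⊗ₜ[ℂ] x) * TensorProduct.map G.antipode LinearMap.id w := by
    intro w
    induction w with
    | zero => simp
    | tmul a b => simp
    | add z w hz hw => simp only [map_add, hz, hw, mul_add]
  rw [canonicalElement, ← opMul_mul_tmul_one, ← h1, ← h.one_tmul_mul_comul_one hx, h2,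
    opMul_one_tmul_mul]

/-- The inverse of κ is * ∘ κ ∘ *, and Δ(1) is invariant both under the involution and under κ ⊗ κ
followed by the flip. -/
theorem star_canonicalElement : G.star G.canonicalElement = G.canonicalElement := by
  let κ' : A →ₗ[ℂ] A := (G.star.comp G.antipode).comp G.star
  have hκ' : ∀ x, κ' (G.antipode x) = x := h.star_antipode_star_antipode
  have h1 : ∀ z : A ⊗[ℂ] A, G.star (opMul (TensorProduct.map G.antipode LinearMap.id z)) =
      LinearMap.mul' ℂ A (TensorProduct.map κ' LinearMap.id (G.tensorStar z)) := by
    intro z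
    induction z with
    | zero => simp
    | tmul a b => simp [h.cstar.antimul, κ', h.cstar.invol]
    | add z w hz hw => simp only [map_add, hz, hw]
  have h2 : ∀ z : A ⊗[ℂ] A,
      LinearMap.mul' ℂ A (TensorProduct.map κ' LinearMap.id (G.tensorAntipode z)) =
        opMul (TensorProduct.map G.antipode LinearMap.id z) := by
    intro z
    induction z with
    | zero => simp
    | tmul a b => simp [hκ']
    | add z w hz hw => simp only [map_add, hz, hw]
  rw [canonicalElement, h1, h.tensorStar_comul_one, ← h.tensorAntipode_comul_one, h2,
    h.tensorAntipode_comul_one]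

theorem sandwich_map_antipode (u : MatrixUnits G.target) (x : A) :
    sandwich x (TensorProduct.map G.antipode LinearMap.id (G.comul 1)) =
      u.centralExpectation (G.canonicalElement * x) := by
  rw [h.map_antipode_comul_one u, sandwich_mul_tmul_one, centralExpectation_eq]

/-- Slicing s(q ⊗ 1) = (κ ⊗ i)Δ(1) with ε on the right gives a left inverse of q, which suffices in
an Artinian ring. -/
theorem isUnit_canonicalElement : IsUnit G.canonicalElement := by
  obtain ⟨u⟩ := h.nonempty_matrixUnits
  have h1 := sliceRight_map G.counit G.antipode LinearMap.id (G.comul 1)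
  rw [h.map_antipode_comul_one u, sliceRight_mul_tmul_one, LinearMap.comp_id,
    h.sliceRight_counit, h.antipode_one] at h1
  have := h.finite
  have : IsArtinianRing A := IsArtinianRing.of_finite ℂ A
  exact IsUnit.of_mul_eq_one_right _ h1

/-- Slicing on the left with ε = ε ∘ κ gives ∑ (1/n) ε(e_ij q) e_ji = 1 = ∑ e_ii; the coefficients
are compared. Thus ε(· q) is the regular trace of A_t. -/
theorem counit_e_mul_canonicalElement (u : MatrixUnits G.target) (γ : Fin u.r)
    (i j : Fin (u.n γ)) :
    G.counit (u.e γ i j * G.canonicalElement) = if i = j then (u.n γ : ℂ) else 0 := by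
  have h1 := sliceLeft_map G.counit G.antipode LinearMap.id (G.comul 1)
  have h2 : G.counit ∘ₗ G.antipode = G.counit := by ext x; exact h.counit_antipode x
  rw [h.map_antipode_comul_one u, sliceLeft_mul_tmul_one, h2, h.sliceLeft_counit,
    LinearMap.id_apply, ← u.sum_diag] at h1
  have h3 : ∑ t : (γ : Fin u.r) × (Fin (u.n γ) × Fin (u.n γ)),
      ((u.n t.1 : ℂ)⁻¹ * G.counit (u.e t.1 t.2.2 t.2.1 * G.canonicalElement) -
        if t.2.1 = t.2.2 then 1 else 0) • u.e t.1 t.2.1 t.2.2 = 0 := by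
    simp only [sub_smul, Finset.sum_sub_distrib]
    rw [sub_eq_zero]
    simp only [Fintype.sum_sigma, Fintype.sum_prod_type, ite_smul, one_smul, zero_smul,
      Finset.sum_ite_eq, Finset.mem_univ, if_true]
    rw [← h1]
    simp only [sep, map_sum, map_smul, sliceLeft_tmul, LinearMap.comp_apply,
      LinearMap.mulRight_apply, mul_smul]
    exact Finset.sum_congr rfl fun γ _ => Finset.sum_comm
  have h4 := Fintype.linearIndependent_iff.1 u.linInd _ h3 ⟨γ, j, i⟩
  have hn : (u.n γ : ℂ) ≠ 0 := Nat.cast_ne_zero.2 (u.n_pos γ).ne'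
  rw [sub_eq_zero, inv_mul_eq_iff_eq_mul₀ hn] at h4
  simp only at h4
  rw [h4]
  simp [eq_comm]

/-- The canonical element is positive. -/
theorem exists_canonicalElement_eq_star_mul_self :
    ∃ b, G.canonicalElement = G.star b * b := by
  have := h.finite
  obtain ⟨u⟩ := h.nonempty_matrixUnits
  let u' : MatrixUnits (h.targetSubalgebra : Set A) := u
  let ε : h.targetSubalgebra →ₗ[ℂ] ℂ := G.counit ∘ₗ h.targetSubalgebra.val.toLinearMap
  let q : h.targetSubalgebra := ⟨G.canonicalElement, h.canonicalElement_mem⟩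
  obtain ⟨b, hb⟩ := h.isCStarInvolution_target.exists_eq_star_mul_self_of_trace ε
    (fun x => h.counit_pos x) (q := q) (Subtype.ext h.star_canonicalElement) (fun x => by
      refine u'.eq_trace_mulLeft (ε ∘ₗ LinearMap.mulRight ℂ q) (fun γ i j => ?_) x
      rw [basis_apply]
      exact h.counit_e_mul_canonicalElement u γ i j)
  exact ⟨b, congrArg Subtype.val hb⟩

/-- The separability element does not depend on the matrix units. -/
theorem sep_eq_sep (u v : MatrixUnits G.target) : u.sep = v.sep := by
  have h1 := h.map_antipode_comul_one u
  rw [h.map_antipode_comul_one v] at h1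
  obtain ⟨q, hq⟩ := h.isUnit_canonicalElement
  have h2 := congrArg (· * ((↑q⁻¹ : A) ⊗ₜ[ℂ] (1 : A))) h1
  simp only [mul_assoc, Algebra.TensorProduct.tmul_mul_tmul, ← hq, Units.mul_inv, mul_one,
    ← Algebra.TensorProduct.one_def] at h2
  exact h2.symm

end IsCStarQuantumGroupoid
end QuantumGroupoidData

/-! ### The deformation by k satisfies the axioms -/

namespace QuantumGroupoidData

variable {A : Type*} [Ring A] [Algebra ℂ A] {G : QuantumGroupoidData A}

theorem deform_star (k : Aˣ) (x : A) : (G.deform k).star x = k * (G.star x * (↑k⁻¹ : A)) := rfl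

theorem deform_comul (k : Aˣ) (x : A) :
    (G.deform k).comul x = G.comul x * (1 ⊗ₜ[ℂ] (↑k⁻¹ : A)) := rfl

theorem deform_antipode (k : Aˣ) (x : A) :
    (G.deform k).antipode x = k * (G.antipode x * (↑k⁻¹ : A)) := rfl

theorem deform_counit (k : Aˣ) (x : A) : (G.deform k).counit x = G.counit (x * k) := rfl

theorem one_tmul_inv_mul_one_tmul (k : Aˣ) :
    ((1 : A) ⊗ₜ[ℂ] (↑k⁻¹ : A)) * ((1 : A) ⊗ₜ[ℂ] (k : A)) = 1 := by
  simp [← Algebra.TensorProduct.one_def]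

theorem mul_one_tmul_inv_injective (k : Aˣ) :
    Function.Injective fun w : A ⊗[ℂ] A => w * (1 ⊗ₜ[ℂ] (↑k⁻¹ : A)) := by
  intro w w' hw
  have h1 := congrArg (· * ((1 : A) ⊗ₜ[ℂ] (k : A))) hw
  simpa only [mul_assoc, one_tmul_inv_mul_one_tmul, mul_one] using h1

theorem counit_sliceRight_counit (w : A ⊗[ℂ] A) :
    G.counit (sliceRight G.counit w) = G.counit (sliceLeft G.counit w) := by
  induction w with
  | zero => simp
  | tmul a b => simp [mul_comm]
  | add z w hz hw => simp only [map_add, hz, hw]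

theorem tensorStar_deform (k : Aˣ) (z : A ⊗[ℂ] A) : (G.deform k).tensorStar z =
    ((k : A) ⊗ₜ[ℂ] (k : A)) * (G.tensorStar z * ((↑k⁻¹ : A) ⊗ₜ[ℂ] (↑k⁻¹ : A))) := by
  induction z with
  | zero => simp
  | tmul a b => simp [deform_star]
  | add z w hz hw => simp only [map_add, hz, hw, mul_add, add_mul]

theorem deform_target (k : Aˣ) : (G.deform k).target = G.target := by
  have h1 : ∀ x : A, G.comul 1 * (1 ⊗ₜ[ℂ] (↑k⁻¹ : A)) * (x ⊗ₜ[ℂ] 1) =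
      G.comul 1 * (x ⊗ₜ[ℂ] 1) * (1 ⊗ₜ[ℂ] (↑k⁻¹ : A)) := fun x => by simp [mul_assoc]
  ext x
  simp only [target, Set.mem_ofPred_eq, deform_comul, h1, ← mul_assoc,
    (mul_one_tmul_inv_injective k).eq_iff]

namespace IsCStarQuantumGroupoid

open MatrixUnits

variable (h : G.IsCStarQuantumGroupoid)
include h

theorem comul_target_mul {x : A} (hx : x ∈ G.target) (y : A) :
    G.comul (x * y) = (x ⊗ₜ[ℂ] 1) * G.comul y := by
  rw [h.comul_mul, hx.2, mul_assoc, h.comul_one_mul]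

theorem comul_mul_target {x : A} (hx : x ∈ G.target) (y : A) :
    G.comul (y * x) = G.comul y * (x ⊗ₜ[ℂ] 1) := by
  rw [h.comul_mul, hx.1, ← mul_assoc, h.comul_mul_one]

theorem one_tmul_mul_comul {x : A} (hx : x ∈ G.target) (y : A) :
    (1 ⊗ₜ[ℂ] x) * G.comul y = (G.antipode x ⊗ₜ[ℂ] 1) * G.comul y := by
  rw [← h.comul_one_mul y, ← mul_assoc, h.one_tmul_mul_comul_one hx, mul_assoc]

theorem comul_mul_tmul_one {x : A} (hx : x ∈ G.source) (y : A) :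
    G.comul y * (x ⊗ₜ[ℂ] 1) = G.comul y * (1 ⊗ₜ[ℂ] G.antipode x) := by
  rw [← h.comul_mul_one y, mul_assoc, h.comul_one_mul_tmul_one hx, mul_assoc]

theorem counit_antipode_mul {x : A} (hx : x ∈ G.target) (y : A) :
    G.counit (G.antipode x * y) = G.counit (x * y) := by
  have h1 : sliceLeft G.counit ((1 ⊗ₜ[ℂ] x) * G.comul y) = x * y := by
    conv_rhs => rw [← h.sliceLeft_counit y]
    generalize G.comul y = w
    induction w with
    | zero => simp
    | tmul a b => simp
    | add z w hz hw => simp only [map_add, hz, hw, mul_add]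
  rw [← h1, h.one_tmul_mul_comul hx, ← counit_sliceRight_counit, sliceRight_tmul_one_mul,
    h.sliceRight_counit]

theorem counit_mul_antipode {x : A} (hx : x ∈ G.source) (y : A) :
    G.counit (y * G.antipode x) = G.counit (y * x) := by
  have h1 : sliceLeft G.counit (G.comul y * (1 ⊗ₜ[ℂ] G.antipode x)) = y * G.antipode x := by
    conv_rhs => rw [← h.sliceLeft_counit y]
    generalize G.comul y = w
    induction w with
    | zero => simp
    | tmul a b => simp
    | add z w hz hw => simp only [map_add, hz, hw, add_mul]
  rw [← h1, ← h.comul_mul_tmul_one hx, ← counit_sliceRight_counit, sliceRight_mul_tmul_one,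
    h.sliceRight_counit]

/-- `Δ(1)(1 ⊗ x)Δ(1) = Δ(1)` as soon as `κ(1₁) x 1₂ = 1`. -/
theorem comul_one_mul_mul_comul_one {x : A} (hx : x ∈ G.target)
    (hx1 : sandwich x (TensorProduct.map G.antipode LinearMap.id (G.comul 1)) = 1) :
    G.comul 1 * (1 ⊗ₜ[ℂ] x) * G.comul 1 = G.comul 1 := by
  obtain ⟨n, a, b, ha, hb, hE⟩ := h.exists_comul_one_eq_sum
  -- With κ(z_j) = x b_j, the hypothesis reads κ(∑ z_j a_j) = 1, so ∑ z_j a_j = 1. Next to Δ(1), the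
  -- factor 1 ⊗ κ(z_j) turns into z_j ⊗ 1 and meets a_j.
  choose z hz hzx using fun j => h.exists_source_antipode_eq (h.mul_mem_target hx (hb j))
  have h1 : ∑ j, z j * a j = 1 := by
    apply h.antipode_injective
    rw [h.antipode_one, ← hx1, hE]
    simp [h.antipode_mul, hzx, mul_assoc]
  have h2 : ∀ j, (1 ⊗ₜ[ℂ] x) * (a j ⊗ₜ[ℂ] b j) =
      ((1 : A) ⊗ₜ[ℂ] G.antipode (z j)) * (a j ⊗ₜ[ℂ] 1) := by
    intro j
    simp [hzx]
  have h3 : G.comul 1 * (1 ⊗ₜ[ℂ] x) * G.comul 1 =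
      G.comul 1 * ((1 ⊗ₜ[ℂ] x) * ∑ j, a j ⊗ₜ[ℂ] b j) := by
    rw [← hE, mul_assoc]
  rw [h3]
  simp only [Finset.mul_sum, h2, ← mul_assoc]
  simp only [← h.comul_one_mul_tmul_one (hz _)]
  simp only [mul_assoc, ← Finset.mul_sum, Algebra.TensorProduct.tmul_mul_tmul, mul_one,
    ← TensorProduct.sum_tmul]
  rw [h1, ← Algebra.TensorProduct.one_def, mul_one]

/-- Writing Δ(y) = Δ(1)Δ(y) puts x between the legs of Δ(1), where κ(1₁) x 1₂ = 1. This absorbs k⁻¹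
in the deformed antipode axiom. -/
theorem antipodeMul_one_tmul_mul {x : A}
    (hx1 : sandwich x (TensorProduct.map G.antipode LinearMap.id (G.comul 1)) = 1) (y : A) :
    G.antipodeMul ((1 ⊗ₜ[ℂ] x) * G.comul y) = G.antipodeMul (G.comul y) := by
  have h1 : ∀ e : A ⊗[ℂ] A, ∀ a b : A, G.antipodeMul ((1 ⊗ₜ[ℂ] x) * (e * (a ⊗ₜ[ℂ] b))) =
      G.antipode a * sandwich x (TensorProduct.map G.antipode LinearMap.id e) * b := by
    intro e a b
    induction e with
    | zero => simp
    | tmul c d => simp [h.antipode_mul, mul_assoc]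
    | add z w hz hw => simp only [map_add, hz, hw, mul_add, add_mul]
  have h2 : ∀ w : A ⊗[ℂ] A, G.antipodeMul ((1 ⊗ₜ[ℂ] x) * (G.comul 1 * w)) = G.antipodeMul w := by
    intro w
    induction w with
    | zero => simp
    | tmul a b => rw [h1, hx1]; simp
    | add z w hz hw => simp only [map_add, hz, hw, mul_add]
  have h3 := h2 (G.comul y)
  rwa [h.comul_one_mul] at h3

section Deform

variable {k : Aˣ} (hk : G.IsDeformationElement G.canonicalElement k)
include hk

theorem inv_deformationElement_mem : (↑k⁻¹ : A) ∈ G.target := h.inv_mem_target hk.mem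

theorem star_deformationElement : G.star k = k := by
  obtain ⟨b, hb⟩ := hk.pos
  rw [hb, h.cstar.antimul, h.cstar.invol]

theorem star_inv_deformationElement : G.star (↑k⁻¹ : A) = ↑k⁻¹ := by
  rw [← Units.mul_eq_one_iff_eq_inv]
  conv_lhs => rw [← h.star_deformationElement hk, ← h.cstar.antimul, Units.mul_inv, h.star_one]

theorem antipode_antipode_inv : G.antipode (G.antipode (↑k⁻¹ : A)) = ↑k⁻¹ := by
  rw [← Units.mul_eq_one_iff_eq_inv]
  conv_lhs =>
    rw [← hk.antipode_sq, ← h.antipode_mul, ← h.antipode_mul, Units.inv_mul, h.antipode_one,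
      h.antipode_one]

theorem star_antipode_deformationElement : G.star (G.antipode k) = G.antipode k := by
  apply h.antipode_injective
  have h1 := h.antipode_star k
  rw [h.star_deformationElement hk] at h1
  rw [h1, hk.antipode_sq]

theorem star_antipode_inv : G.star (G.antipode (↑k⁻¹ : A)) = G.antipode (↑k⁻¹ : A) := by
  apply h.antipode_injective
  have h1 := h.antipode_star (↑k⁻¹ : A)
  rw [h.star_inv_deformationElement hk] at h1
  rw [h1, h.antipode_antipode_inv hk]

theorem commute_canonicalElement : Commute G.canonicalElement (k : A) := by
  have h1 := h.canonicalElement_mul_antipode_antipode hk.mem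
  rwa [hk.antipode_sq] at h1

/-- The expectation condition on k in the form used by the axioms; passing from qk⁻¹ to k⁻¹q needs
that k commutes with q. -/
theorem sandwich_inv :
    sandwich (↑k⁻¹ : A) (TensorProduct.map G.antipode LinearMap.id (G.comul 1)) = 1 := by
  obtain ⟨u⟩ := h.nonempty_matrixUnits
  rw [h.sandwich_map_antipode u, ← hk.expectation u,
    (h.commute_canonicalElement hk).units_inv_right.eq]

theorem exists_isUnit_star_mul_self : ∃ b, (k : A) = G.star b * b ∧ IsUnit b := by
  obtain ⟨b, hb⟩ := hk.pos
  have := h.finite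
  have : IsArtinianRing A := IsArtinianRing.of_finite ℂ A
  refine ⟨b, hb, IsUnit.of_mul_eq_one_right (↑k⁻¹ * G.star b) ?_⟩
  rw [mul_assoc, ← hb, Units.inv_mul]

theorem exists_inv_eq_star_mul_self : ∃ v, (↑k⁻¹ : A) = G.star v * v := by
  obtain ⟨_, hb, ⟨b, rfl⟩⟩ := h.exists_isUnit_star_mul_self hk
  refine ⟨G.star (↑b⁻¹ : A), ?_⟩
  rw [h.cstar.invol, eq_comm, ← Units.mul_eq_one_iff_eq_inv, hb, mul_assoc,
    ← mul_assoc _ _ (b : A), ← h.cstar.antimul, Units.mul_inv, h.star_one, one_mul, Units.inv_mul]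

theorem deform_comul_mul (x y : A) :
    (G.deform k).comul (x * y) = (G.deform k).comul x * (G.deform k).comul y := by
  have hE := h.comul_one_mul_mul_comul_one (h.inv_deformationElement_mem hk) (h.sandwich_inv hk)
  simp only [deform_comul]
  rw [← mul_assoc]
  congr 1
  calc G.comul (x * y) = G.comul x * G.comul 1 * G.comul y := by rw [h.comul_mul_one, h.comul_mul]
    _ = G.comul x * G.comul 1 * (1 ⊗ₜ[ℂ] (↑k⁻¹ : A)) * (G.comul 1 * G.comul y) := by
        conv_lhs => rw [← hE]
        simp only [mul_assoc]
    _ = _ := by rw [h.comul_mul_one, h.comul_one_mul]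

theorem deform_comul_star (x : A) :
    (G.deform k).comul ((G.deform k).star x) = (G.deform k).tensorStar ((G.deform k).comul x) := by
  rw [tensorStar_deform]
  simp only [deform_comul, deform_star]
  rw [h.comul_target_mul hk.mem, h.comul_mul_target (h.inv_deformationElement_mem hk), h.tensorStar_mul,
    tensorStar_tmul, h.star_one, h.star_inv_deformationElement hk, h.comul_star]
  simp only [← mul_assoc]
  simp [mul_assoc]

theorem deform_coassoc (x : A) : TensorProduct.assoc ℂ A A A
      (TensorProduct.map (G.deform k).comul LinearMap.id ((G.deform k).comul x)) =
    TensorProduct.map LinearMap.id (G.deform k).comul ((G.deform k).comul x) := by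
  have h1 : ∀ z : A ⊗[ℂ] A, TensorProduct.map (G.deform k).comul LinearMap.id
      (z * (1 ⊗ₜ[ℂ] (↑k⁻¹ : A))) = TensorProduct.map G.comul LinearMap.id z *
        ((1 ⊗ₜ[ℂ] (↑k⁻¹ : A)) ⊗ₜ[ℂ] (↑k⁻¹ : A)) := by
    intro z
    induction z with
    | zero => simp
    | tmul a b => simp [deform_comul]
    | add z w hz hw => simp only [map_add, hz, hw, add_mul]
  have h2 : ∀ z : A ⊗[ℂ] A, TensorProduct.map LinearMap.id (G.deform k).comul
      (z * (1 ⊗ₜ[ℂ] (↑k⁻¹ : A))) = TensorProduct.map LinearMap.id G.comul z *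
        ((1 : A) ⊗ₜ[ℂ] ((↑k⁻¹ : A) ⊗ₜ[ℂ] (↑k⁻¹ : A))) := by
    intro z
    induction z with
    | zero => simp
    | tmul a b =>
      simp [deform_comul, h.comul_mul_target (h.inv_deformationElement_mem hk), mul_assoc]
    | add z w hz hw => simp only [map_add, hz, hw, add_mul]
  have h3 : ∀ w : (A ⊗[ℂ] A) ⊗[ℂ] A, TensorProduct.assoc ℂ A A A
      (w * ((1 ⊗ₜ[ℂ] (↑k⁻¹ : A)) ⊗ₜ[ℂ] (↑k⁻¹ : A))) = TensorProduct.assoc ℂ A A A w *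
        ((1 : A) ⊗ₜ[ℂ] ((↑k⁻¹ : A) ⊗ₜ[ℂ] (↑k⁻¹ : A))) := by
    intro w
    induction w with
    | zero => simp
    | tmul p c =>
      induction p with
      | zero => simp
      | tmul a b => simp
      | add z w hz hw => simp only [TensorProduct.add_tmul, map_add, hz, hw, add_mul]
    | add z w hz hw => simp only [map_add, hz, hw, add_mul]
  rw [deform_comul, h1, h2, h3, h.coassoc]

theorem deform_antipode_star (x : A) : (G.deform k).antipode ((G.deform k).star
    ((G.deform k).antipode ((G.deform k).star x))) = x := by
  simp only [deform_antipode, deform_star, h.antipode_mul, h.cstar.antimul, h.star_deformationElement hk,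
    h.star_inv_deformationElement hk, h.star_antipode_deformationElement hk, h.star_antipode_inv hk,
    hk.antipode_sq, h.antipode_antipode_inv hk, h.antipode_star, mul_assoc,
    Units.mul_inv_cancel_left, Units.mul_inv, mul_one]

omit hk in
theorem deform_antipode_mul (x y : A) : (G.deform k).antipode (x * y) =
    (G.deform k).antipode y * (G.deform k).antipode x := by
  simp only [deform_antipode, h.antipode_mul, mul_assoc, Units.inv_mul_cancel_left]

theorem deform_antipode_comul (x : A) : TensorProduct.map (G.deform k).antipode
    (G.deform k).antipode ((G.deform k).comul x) =
      TensorProduct.comm ℂ A A ((G.deform k).comul ((G.deform k).antipode x)) := by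
  have h1 : ∀ z : A ⊗[ℂ] A, TensorProduct.map (G.deform k).antipode (G.deform k).antipode
      (z * (1 ⊗ₜ[ℂ] (↑k⁻¹ : A))) = ((k : A) ⊗ₜ[ℂ] (k * G.antipode (↑k⁻¹ : A))) *
        TensorProduct.map G.antipode G.antipode z * ((↑k⁻¹ : A) ⊗ₜ[ℂ] (↑k⁻¹ : A)) := by
    intro z
    induction z with
    | zero => simp
    | tmul a b => simp [deform_antipode, h.antipode_mul, mul_assoc]
    | add z w hz hw => simp only [map_add, hz, hw, add_mul, mul_add]
  have h2 : ∀ w : A ⊗[ℂ] A, ((k : A) ⊗ₜ[ℂ] (k * G.antipode (↑k⁻¹ : A))) *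
      TensorProduct.comm ℂ A A w * ((↑k⁻¹ : A) ⊗ₜ[ℂ] (↑k⁻¹ : A)) =
        TensorProduct.comm ℂ A A (((k : A) ⊗ₜ[ℂ] (k : A)) * ((G.antipode (↑k⁻¹ : A) ⊗ₜ[ℂ] 1) * w)
          * ((↑k⁻¹ : A) ⊗ₜ[ℂ] (↑k⁻¹ : A))) := by
    intro w
    induction w with
    | zero => simp
    | tmul a b => simp [mul_assoc]
    | add z w hz hw => simp only [map_add, hz, hw, add_mul, mul_add]
  -- The factor κ(k⁻¹), moved to the first leg by the flip, can be traded for k⁻¹ on the second leg,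
  -- where it cancels k.
  rw [deform_comul, h1, h.antipode_comul, h2, ← h.one_tmul_mul_comul (h.inv_deformationElement_mem hk),
    deform_comul, deform_antipode, h.comul_target_mul hk.mem,
    h.comul_mul_target (h.inv_deformationElement_mem hk)]
  congr 1
  simp only [← mul_assoc, Algebra.TensorProduct.tmul_mul_tmul, mul_one, Units.mul_inv]
  simp [mul_assoc]

theorem deform_antipode_axiom (x : A) : TensorProduct.map
      (LinearMap.mul' ℂ A ∘ₗ TensorProduct.map (G.deform k).antipode LinearMap.id) LinearMap.id
      (TensorProduct.map (G.deform k).comul LinearMap.id ((G.deform k).comul x)) =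
    (1 ⊗ₜ[ℂ] x) * (G.deform k).comul 1 := by
  have h1 : ∀ z : A ⊗[ℂ] A, (LinearMap.mul' ℂ A ∘ₗ
      TensorProduct.map (G.deform k).antipode LinearMap.id) (z * (1 ⊗ₜ[ℂ] (↑k⁻¹ : A))) =
        k * G.antipodeMul ((1 ⊗ₜ[ℂ] (↑k⁻¹ : A)) * z) * (↑k⁻¹ : A) := by
    intro z
    induction z with
    | zero => simp
    | tmul a b => simp [deform_antipode, mul_assoc]
    | add z w hz hw => simp only [map_add, hz, hw, add_mul, mul_add]
  have h2 : ∀ z : A ⊗[ℂ] A, TensorProduct.map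
      (LinearMap.mul' ℂ A ∘ₗ TensorProduct.map (G.deform k).antipode LinearMap.id) LinearMap.id
      (TensorProduct.map (G.deform k).comul LinearMap.id (z * (1 ⊗ₜ[ℂ] (↑k⁻¹ : A)))) =
        ((k : A) ⊗ₜ[ℂ] 1) * TensorProduct.map (G.antipodeMul ∘ₗ G.comul) LinearMap.id z *
          ((↑k⁻¹ : A) ⊗ₜ[ℂ] (↑k⁻¹ : A)) := by
    intro z
    induction z with
    | zero => simp
    | tmul a b =>
      simp only [Algebra.TensorProduct.tmul_mul_tmul, TensorProduct.map_tmul, deform_comul, h1,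
        h.antipodeMul_one_tmul_mul (h.sandwich_inv hk), LinearMap.id_apply, LinearMap.comp_apply,
        mul_one, one_mul]
    | add z w hz hw => simp only [map_add, hz, hw, add_mul, mul_add]
  have hd := h.inv_deformationElement_mem hk
  have h3 : G.comul 1 * ((↑k⁻¹ : A) ⊗ₜ[ℂ] (↑k⁻¹ : A)) =
      ((↑k⁻¹ : A) ⊗ₜ[ℂ] 1) * (G.comul 1 * (1 ⊗ₜ[ℂ] (↑k⁻¹ : A))) := by
    rw [← mul_assoc, ← hd.2, hd.1, mul_assoc, Algebra.TensorProduct.tmul_mul_tmul, one_mul,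
      mul_one]
  rw [deform_comul, h2, h.antipodeMul_comul_mul, deform_comul, mul_assoc, mul_assoc, h3]
  simp only [← mul_assoc]
  simp

/-- In ε(k x* k⁻¹ x k) the outer factors k may be replaced by the self-adjoint κ(k). With k⁻¹ = v*v
this is ε(w*w) for w = v x κ(k). -/
theorem deform_counit_pos (x : A) : 0 ≤ (G.deform k).counit ((G.deform k).star x * x) := by
  obtain ⟨v, hv⟩ := h.exists_inv_eq_star_mul_self hk
  have h1 := h.counit_mul_antipode (h.antipode_mem_source hk.mem)
  rw [hk.antipode_sq] at h1
  rw [deform_counit, deform_star, h1, mul_assoc, mul_assoc, ← h.counit_antipode_mul hk.mem, hv]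
  have h2 := h.counit_pos (v * x * G.antipode k)
  simp only [h.cstar.antimul, h.star_antipode_deformationElement hk] at h2
  simpa only [mul_assoc] using h2

theorem deform_counit_left (x : A) : TensorProduct.lid ℂ A
    (TensorProduct.map (G.deform k).counit LinearMap.id ((G.deform k).comul x)) = x := by
  have h1 : ∀ z : A ⊗[ℂ] A, TensorProduct.lid ℂ A
      (TensorProduct.map (G.deform k).counit LinearMap.id (z * (1 ⊗ₜ[ℂ] (↑k⁻¹ : A)))) =
        sliceLeft G.counit (z * ((k : A) ⊗ₜ[ℂ] 1)) * (↑k⁻¹ : A) := by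
    intro z
    induction z with
    | zero => simp
    | tmul a b => simp [deform_counit]
    | add z w hz hw => simp only [map_add, hz, hw, add_mul]
  rw [deform_comul, h1, ← h.comul_mul_target hk.mem, h.sliceLeft_counit, Units.mul_inv_cancel_right]

omit hk in
theorem deform_counit_right (x : A) : TensorProduct.rid ℂ A
    (TensorProduct.map LinearMap.id (G.deform k).counit ((G.deform k).comul x)) = x := by
  have h1 : ∀ z : A ⊗[ℂ] A, TensorProduct.rid ℂ A
      (TensorProduct.map LinearMap.id (G.deform k).counit (z * (1 ⊗ₜ[ℂ] (↑k⁻¹ : A)))) =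
        sliceRight G.counit z := by
    intro z
    induction z with
    | zero => simp
    | tmul a b => simp [deform_counit]
    | add z w hz hw => simp only [map_add, hz, hw, add_mul]
  rw [deform_comul, h1, h.sliceRight_counit]

theorem deform_counit_mul (x y : A) : LinearMap.mul' ℂ ℂ (TensorProduct.map (G.deform k).counit
    (G.deform k).counit ((x ⊗ₜ[ℂ] 1) * (G.deform k).comul 1 * (1 ⊗ₜ[ℂ] y))) =
      (G.deform k).counit (x * y) := by
  have h1 : ∀ z : A ⊗[ℂ] A, LinearMap.mul' ℂ ℂ (TensorProduct.map (G.deform k).counit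
      (G.deform k).counit z) = LinearMap.mul' ℂ ℂ (TensorProduct.map G.counit G.counit
        (z * ((k : A) ⊗ₜ[ℂ] (k : A)))) := by
    intro z
    induction z with
    | zero => simp
    | tmul a b => simp [deform_counit]
    | add z w hz hw => simp only [map_add, hz, hw, add_mul]
  have h2 : (x ⊗ₜ[ℂ] 1) * (G.deform k).comul 1 * (1 ⊗ₜ[ℂ] y) * ((k : A) ⊗ₜ[ℂ] (k : A)) =
      ((x * k) ⊗ₜ[ℂ] 1) * G.comul 1 * (1 ⊗ₜ[ℂ] ((↑k⁻¹ : A) * y * k)) := by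
    have e1 : ((x * (k : A)) ⊗ₜ[ℂ] (1 : A)) = (x ⊗ₜ[ℂ] 1) * ((k : A) ⊗ₜ[ℂ] 1) := by simp
    rw [e1, mul_assoc (x ⊗ₜ[ℂ] 1) _ (G.comul 1), ← hk.mem.2, hk.mem.1, deform_comul]
    simp [mul_assoc]
  rw [h1, h2, h.counit_mul, deform_counit]
  simp only [mul_assoc, Units.mul_inv_cancel_left]

theorem deform_isCStarQuantumGroupoid : (G.deform k).IsCStarQuantumGroupoid where
  finite := h.finite
  cstar := by
    obtain ⟨b, hb, hbu⟩ := h.exists_isUnit_star_mul_self hk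
    exact h.cstar.conjMap_comp k hb hbu
  comul_mul := h.deform_comul_mul hk
  comul_star := h.deform_comul_star hk
  coassoc := h.deform_coassoc hk
  antipode_star := h.deform_antipode_star hk
  antipode_mul := h.deform_antipode_mul
  antipode_comul := h.deform_antipode_comul hk
  antipode_axiom := deform_antipode_axiom h hk
  counit_pos := h.deform_counit_pos hk
  counit_left := h.deform_counit_left hk
  counit_right := h.deform_counit_right
  counit_mul := h.deform_counit_mul hk

theorem deform_source : (G.deform k).source = G.source := by
  ext x
  have h2 : G.comul 1 * (1 ⊗ₜ[ℂ] (↑k⁻¹ : A)) * (1 ⊗ₜ[ℂ] x) =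
      G.comul 1 * (1 ⊗ₜ[ℂ] ((↑k⁻¹ : A) * x)) := by simp [mul_assoc]
  simp only [source, Set.mem_ofPred_eq, deform_comul, h2, ← mul_assoc,
    (mul_one_tmul_inv_injective k).eq_iff]
  have hcomm : x ∈ G.source → (G.comul 1 * (1 ⊗ₜ[ℂ] ((↑k⁻¹ : A) * x)) =
      G.comul 1 * (1 ⊗ₜ[ℂ] x) * (1 ⊗ₜ[ℂ] (↑k⁻¹ : A))) := fun hx => by
    rw [(h.commute_target_source (h.inv_deformationElement_mem hk) hx).eq]
    simp [mul_assoc]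
  constructor
  -- One identity is enough: applying i ⊗ ε to Δ(x) = (1 ⊗ x)Δ(1) exhibits x as a right slice of
  -- Δ(1).
  · rintro ⟨-, hx⟩
    have h3 := congrArg (sliceRight G.counit) hx
    rw [h.sliceRight_counit, sliceRight_one_tmul_mul] at h3
    have h4 : x ∈ G.source := h3 ▸ h.sliceRight_mem_source _
    exact h4
  · intro hx
    refine ⟨?_, hx.2⟩
    rw [hcomm hx, ← hx.1]

theorem deform_canonicalElement :
    (G.deform k).canonicalElement = (↑k⁻¹ : A) * G.canonicalElement := by
  have h1 : ∀ z : A ⊗[ℂ] A, opMul (TensorProduct.map (G.deform k).antipode LinearMap.id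
      (z * (1 ⊗ₜ[ℂ] (↑k⁻¹ : A)))) =
        opMul (TensorProduct.map G.antipode LinearMap.id z) * (↑k⁻¹ : A) := by
    intro z
    induction z with
    | zero => simp
    | tmul a b => simp [deform_antipode, mul_assoc]
    | add z w hz hw => simp only [map_add, hz, hw, add_mul]
  rw [canonicalElement, deform_comul, h1, ← (h.commute_canonicalElement hk).units_inv_right.eq,
    canonicalElement]

end Deform

end IsCStarQuantumGroupoid
end QuantumGroupoidData

/-! ### Construction of deformation elements and the isomorphism invariant -/

namespace QuantumGroupoidData

variable {A : Type*} [Ring A] [Algebra ℂ A] {G : QuantumGroupoidData A}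

open MatrixUnits

namespace IsCStarQuantumGroupoid

variable (h : G.IsCStarQuantumGroupoid)
include h

/-- The matrix units need not be self-adjoint as a system, so uniqueness is used: the adjoint tensor
has the same intertwining property and the same normalization. -/
theorem tensorStar_sep (u : MatrixUnits G.target) : G.tensorStar u.sep = u.sep := by
  have h1 : ∀ x ∈ G.target,
      (x ⊗ₜ[ℂ] 1) * G.tensorStar u.sep = G.tensorStar u.sep * ((1 : A) ⊗ₜ[ℂ] x) := by
    intro x hx
    have h2 := congrArg G.tensorStar (u.mul_sep_right (h.star_mem_target hx))
    simp only [h.tensorStar_mul, tensorStar_tmul, h.star_one, h.cstar.invol] at h2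
    exact h2.symm
  have h3 : G.tensorStar u.sep = ∑ t : (γ : Fin u.r) × (Fin (u.n γ) × Fin (u.n γ)),
      ((u.n t.1 : ℂ)⁻¹ • G.star (u.e t.1 t.2.1 t.2.2)) ⊗ₜ[ℂ] G.star (u.e t.1 t.2.2 t.2.1) := by
    simp [sep, Fintype.sum_sigma, Fintype.sum_prod_type, TensorProduct.smul_tmul']
  have h4 := u.eq_sep_mul h1 h3 fun t => h.star_mem_target (u.e_mem _ _ _)
  have h5 : ∑ t : (γ : Fin u.r) × (Fin (u.n γ) × Fin (u.n γ)),
      G.star (u.e t.1 t.2.2 t.2.1) * ((u.n t.1 : ℂ)⁻¹ • G.star (u.e t.1 t.2.1 t.2.2)) = 1 := by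
    rw [← h.star_one, ← u.sum_e_mul_e]
    simp [Fintype.sum_sigma, Fintype.sum_prod_type, h.cstar.antimul]
  rw [h4, h5, ← Algebra.TensorProduct.one_def, mul_one]

theorem star_centralExpectation (u : MatrixUnits G.target) (x : A) :
    G.star (u.centralExpectation x) = u.centralExpectation (G.star x) := by
  have h1 : ∀ z : A ⊗[ℂ] A, G.star (sandwich x z) =
      sandwich (G.star x) (TensorProduct.comm ℂ A A (G.tensorStar z)) := by
    intro z
    induction z with
    | zero => simp
    | tmul a b => simp [h.cstar.antimul, mul_assoc]
    | add z w hz hw => simp only [map_add, hz, hw]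
  rw [centralExpectation_eq, h1, h.tensorStar_sep, u.comm_sep, centralExpectation_eq]

theorem exists_noncommuting_target
    (hnonab : (∃ x ∈ G.target, ∃ y ∈ G.target, x * y ≠ y * x) ∨
      (∃ x ∈ G.source, ∃ y ∈ G.source, x * y ≠ y * x)) :
    ∃ x ∈ G.target, ∃ y ∈ G.target, ¬ Commute x y := by
  rcases hnonab with h1 | ⟨x, hx, y, hy, hxy⟩
  · exact h1
  · refine ⟨_, h.antipode_mem_target hx, _, h.antipode_mem_target hy, fun hc => hxy ?_⟩
    apply h.antipode_injective
    rw [h.antipode_mul, h.antipode_mul]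
    exact hc.eq.symm

/-- A self-adjoint noncentral element of `A_t` that commutes with the canonical element. -/
theorem exists_selfAdjoint_noncentral (hN : ∃ x ∈ G.target, ∃ y ∈ G.target, ¬ Commute x y) :
    ∃ g ∈ G.target, G.star g = g ∧ Commute G.canonicalElement g ∧
      ∃ y ∈ G.target, ¬ Commute g y := by
  -- If q is central in A_t, commuting with q is no constraint, and the real or the imaginary part
  -- of a noncentral x serves. Otherwise q itself does.
  by_cases hq : ∀ y ∈ G.target, Commute G.canonicalElement y
  · obtain ⟨x, hx, y, hy, hxy⟩ := hN
    have hsx := h.star_mem_target hx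
    by_cases h1 : Commute (x + G.star x) y
    · have hmem : Complex.I • (x - G.star x) ∈ G.target :=
        h.targetSubalgebra.smul_mem (h.targetSubalgebra.sub_mem hx hsx) _
      refine ⟨_, hmem, ?_, hq _ hmem, y, hy, fun h2 => hxy ?_⟩
      · rw [map_smulₛₗ, map_sub, h.cstar.invol, Complex.conj_I, neg_smul, ← smul_neg, neg_sub]
      · have h3 : x = (2⁻¹ : ℂ) • ((x + G.star x) +
            (-Complex.I) • (Complex.I • (x - G.star x))) := by
          rw [smul_smul, neg_mul, Complex.I_mul_I, neg_neg, one_smul, add_add_sub_cancel,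
            ← two_smul ℂ x, smul_smul, inv_mul_cancel₀ two_ne_zero, one_smul]
        rw [h3]
        exact (h1.add_left (h2.smul_left _)).smul_left _
    · have hmem : x + G.star x ∈ G.target := h.targetSubalgebra.add_mem hx hsx
      exact ⟨_, hmem, by rw [map_add, h.cstar.invol, add_comm], hq _ hmem, y, hy, h1⟩
  · push Not at hq
    exact ⟨_, h.canonicalElement_mem, h.star_canonicalElement, Commute.refl _, hq⟩

/-- Subtracting its central expectation from a noncentral g leaves a nonzero element, and the
subtracted part, being central in A_t, still commutes with q. -/
theorem exists_direction (hN : ∃ x ∈ G.target, ∃ y ∈ G.target, ¬ Commute x y) :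
    ∃ g ∈ G.target, G.star g = g ∧ g ≠ 0 ∧ Commute G.canonicalElement g ∧
      ∀ u : MatrixUnits G.target, u.centralExpectation g = 0 := by
  obtain ⟨g, hg, hgs, hqg, y, hy, hgy⟩ := h.exists_selfAdjoint_noncentral hN
  obtain ⟨u⟩ := h.nonempty_matrixUnits
  have hE : u.centralExpectation g ∈ G.target :=
    centralExpectation_mem (S := h.targetSubalgebra) u hg
  have hsub : g - u.centralExpectation g = g + (-1 : ℂ) • u.centralExpectation g := by
    rw [neg_one_smul, sub_eq_add_neg]
  refine ⟨g - u.centralExpectation g, h.targetSubalgebra.sub_mem hg hE, ?_, fun h0 => hgy ?_,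
    hqg.sub_right (u.commute_centralExpectation g h.canonicalElement_mem), fun v => ?_⟩
  · rw [map_sub, h.star_centralExpectation, hgs]
  · rw [sub_eq_zero.1 h0]
    exact (u.commute_centralExpectation g hy).symm
  · rw [centralExpectation_eq, h.sep_eq_sep v u, ← centralExpectation_eq, hsub,
      centralExpectation_add, centralExpectation_smul,
      u.centralExpectation_of_commute fun y hy => (u.commute_centralExpectation g hy).symm,
      neg_one_smul, add_neg_cancel]

/-- If `1 + t g` is a positive invertible element, then `q (1 + t g)⁻¹` is a deformation
element. -/
theorem exists_isDeformationElement {g : A} (hg : g ∈ G.target)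
    (hqg : Commute G.canonicalElement g)
    (hE : ∀ u : MatrixUnits G.target, u.centralExpectation g = 0) {c : ℂ}
    (hu : IsUnit (1 + c • g))
    (hpos : ∀ w : Aˣ, (w : A) = 1 + c • g →
      ∃ b, G.canonicalElement * (↑w⁻¹ : A) = G.star b * b) :
    ∃ k : Aˣ, G.IsDeformationElement G.canonicalElement k ∧
      (↑k⁻¹ : A) * G.canonicalElement = 1 + c • g := by
  obtain ⟨w, hw⟩ := hu
  obtain ⟨q, hq⟩ := h.isUnit_canonicalElement
  have hwmem : (w : A) ∈ G.target := by
    rw [hw]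
    exact h.targetSubalgebra.add_mem h.targetSubalgebra.one_mem
      (h.targetSubalgebra.smul_mem hg _)
  have hqw : Commute G.canonicalElement (w : A) := by
    rw [hw]
    exact (Commute.one_right _).add_right (hqg.smul_right _)
  have hk : ((q * w⁻¹ : Aˣ) : A) = G.canonicalElement * (↑w⁻¹ : A) := by
    rw [Units.val_mul, hq]
  have hkq : (↑(q * w⁻¹)⁻¹ : A) * G.canonicalElement = w := by
    rw [mul_inv_rev, inv_inv, Units.val_mul, mul_assoc, ← hq, Units.inv_mul, mul_one]
  have hmem : ((q * w⁻¹ : Aˣ) : A) ∈ G.target := by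
    rw [hk]
    exact h.mul_mem_target h.canonicalElement_mem (h.inv_mem_target hwmem)
  refine ⟨q * w⁻¹, ⟨hmem, ?_, ?_, fun u => ?_⟩, by rw [hkq, hw]⟩
  · obtain ⟨b, hb⟩ := hpos w hw
    exact ⟨b, by rw [hk, hb]⟩
  -- Invariance under κ² is automatic, since k is built from q and w and so commutes with q.
  · have h1 := h.canonicalElement_mul_antipode_antipode hmem
    have h2 : Commute G.canonicalElement ((q * w⁻¹ : Aˣ) : A) := by
      rw [hk]
      exact (Commute.refl _).mul_right hqw.units_inv_right
    rw [← h2.eq, ← hq] at h1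
    exact q.isUnit.mul_left_cancel h1
  · rw [hkq, hw, centralExpectation_add, centralExpectation_smul, hE, smul_zero, add_zero,
      u.centralExpectation_of_commute fun y _ => Commute.one_left y]

/-- The antipode is involutive on `A_t` only if the canonical element is central in `A_t`. -/
theorem commute_canonicalElement_of_involutive
    (hκ : ∀ x ∈ G.target, G.antipode (G.antipode x) = x) {x : A} (hx : x ∈ G.target) :
    Commute G.canonicalElement x := by
  have h1 := h.canonicalElement_mul_antipode_antipode hx
  rwa [hκ x hx] at h1

theorem antipode_antipode_target_of_source
    (hκ : ∀ x ∈ G.source, G.antipode (G.antipode x) = x) {x : A} (hx : x ∈ G.target) :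
    G.antipode (G.antipode x) = x := by
  obtain ⟨y, hy, rfl⟩ := h.exists_source_antipode_eq hx
  rw [hκ y hy]

end IsCStarQuantumGroupoid

theorem Iso.spectrum_canonicalElement_eq {B : Type*} [Ring B] [Algebra ℂ B]
    {H : QuantumGroupoidData B} (hi : G.Iso H) :
    spectrum ℂ G.canonicalElement = spectrum ℂ H.canonicalElement := by
  obtain ⟨φ, -, hcomul, hantipode, -⟩ := hi
  have h1 : ∀ z : A ⊗[ℂ] A, φ (opMul (TensorProduct.map G.antipode LinearMap.id z)) =
      opMul (TensorProduct.map H.antipode LinearMap.id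
        (TensorProduct.map φ.toLinearMap φ.toLinearMap z)) := by
    intro z
    induction z with
    | zero => simp
    | tmul a b => simp [hantipode]
    | add z w hz hw => simp only [map_add, hz, hw]
  have h2 : φ G.canonicalElement = H.canonicalElement := by
    rw [canonicalElement, h1, hcomul, map_one, canonicalElement]
  rw [← h2, AlgEquiv.spectrum_eq]

end QuantumGroupoidData
end

theorem corollary2p8 {A : Type*} [Ring A] [Algebra ℂ A] (G : QuantumGroupoidData A)
    (hG : G.IsCStarQuantumGroupoid)
    (hnonab : (∃ x ∈ G.target, ∃ y ∈ G.target, x * y ≠ y * x) ∨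
      (∃ x ∈ G.source, ∃ y ∈ G.source, x * y ≠ y * x)) :
    ∃ q : A,
      -- `q` is the unique canonical element of `G`
      (∀ x, G.IsCanonical x ↔ x = q) ∧
      -- the deformations are C*-quantum groupoids on the algebra `A`, with the same Cartan
      -- subalgebras and with canonical element `k⁻¹ q`
      (∀ k : Aˣ, G.IsDeformationElement q k →
        (G.deform k).IsCStarQuantumGroupoid ∧
        (G.deform k).target = G.target ∧ (G.deform k).source = G.source ∧
        ∀ x, (G.deform k).IsCanonical x ↔ x = (↑k⁻¹ : A) * q) ∧
      -- for one of them the antipode is involutive on neither Cartan subalgebra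
      (∃ k : Aˣ, G.IsDeformationElement q k ∧
        (∃ x ∈ (G.deform k).target,
          (G.deform k).antipode ((G.deform k).antipode x) ≠ x) ∧
        (∃ x ∈ (G.deform k).source,
          (G.deform k).antipode ((G.deform k).antipode x) ≠ x)) ∧
      -- the spectrum of `k⁻¹ q` is an invariant of the isomorphism class
      (∀ k k' : Aˣ, G.IsDeformationElement q k → G.IsDeformationElement q k' →
        (G.deform k).Iso (G.deform k') →
        spectrum ℂ ((↑k⁻¹ : A) * q) = spectrum ℂ ((↑k'⁻¹ : A) * q)) ∧
      -- uncountably many of them are pairwise non-isomorphic, with pairwise different spectra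
      (∃ K : Set Aˣ, ¬ K.Countable ∧ (∀ k ∈ K, G.IsDeformationElement q k) ∧
        K.Pairwise (fun k k' =>
          spectrum ℂ ((↑k⁻¹ : A) * q) ≠ spectrum ℂ ((↑k'⁻¹ : A) * q) ∧
          ¬ (G.deform k).Iso (G.deform k'))) := by
  have := hG.finite
  have hspec : ∀ k k' : Aˣ, G.IsDeformationElement G.canonicalElement k →
      G.IsDeformationElement G.canonicalElement k' → (G.deform k).Iso (G.deform k') →
      spectrum ℂ ((↑k⁻¹ : A) * G.canonicalElement) =
        spectrum ℂ ((↑k'⁻¹ : A) * G.canonicalElement) := fun k k' hk hk' hi => by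
    rw [← hG.deform_canonicalElement hk, ← hG.deform_canonicalElement hk']
    exact hi.spectrum_canonicalElement_eq
  obtain ⟨g, hg, hgs, hg0, hqg, hgE⟩ := hG.exists_direction (hG.exists_noncommuting_target hnonab)
  obtain ⟨δ, hδ, hpert, hne⟩ := hG.cstar.exists_perturbation
    hG.exists_canonicalElement_eq_star_mul_self hgs hg0 hqg
  have hex : ∀ t : ℝ, ∃ k : Aˣ, t ∈ Set.Ioo 0 δ → G.IsDeformationElement G.canonicalElement k ∧
      (↑k⁻¹ : A) * G.canonicalElement = 1 + (t : ℂ) • g := by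
    intro t
    by_cases ht : t ∈ Set.Ioo 0 δ
    · obtain ⟨k, hk⟩ := hG.exists_isDeformationElement hg hqg hgE (hpert t ht).1 (hpert t ht).2
      exact ⟨k, fun _ => hk⟩
    · exact ⟨1, fun ht' => absurd ht' ht⟩
  choose k hk using hex
  refine ⟨G.canonicalElement, hG.isCanonical_iff, fun k hk => ⟨hG.deform_isCStarQuantumGroupoid hk,
    QuantumGroupoidData.deform_target k, hG.deform_source hk, fun x => ?_⟩, ?_, hspec,
    k '' Set.Ioo 0 δ, fun hc => ?_, ?_, ?_⟩
  · rw [(hG.deform_isCStarQuantumGroupoid hk).isCanonical_iff, hG.deform_canonicalElement hk]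
  · have ht : δ / 2 ∈ Set.Ioo 0 δ := ⟨by positivity, by linarith⟩
    obtain ⟨hkD, hkq⟩ := hk _ ht
    have hH := hG.deform_isCStarQuantumGroupoid hkD
    -- An involutive κ_k on A_t would make 1 + tg, and hence g, central in A_t; then g = E(g) = 0.
    -- The value t = δ/2 is an arbitrary point of the interval.
    have key : ¬ ∀ x ∈ (G.deform (k (δ / 2))).target, (G.deform (k (δ / 2))).antipode
        ((G.deform (k (δ / 2))).antipode x) = x := by
      intro hinv
      have hcomm : ∀ y ∈ G.target, Commute g y := by
        intro y hy
        have h1 := hH.commute_canonicalElement_of_involutive hinv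
          ((QuantumGroupoidData.deform_target (G := G) (k (δ / 2))).superset hy)
        rw [hG.deform_canonicalElement hkD, hkq] at h1
        have h2 := h1.sub_left (Commute.one_left y)
        rw [add_sub_cancel_left] at h2
        have hc : ((δ / 2 : ℝ) : ℂ) ≠ 0 := Complex.ofReal_ne_zero.2 ht.1.ne'
        have h3 := h2.smul_left ((δ / 2 : ℝ) : ℂ)⁻¹
        rwa [smul_smul, inv_mul_cancel₀ hc, one_smul] at h3
      obtain ⟨u⟩ := hG.nonempty_matrixUnits
      exact hg0 (by rw [← u.centralExpectation_of_commute hcomm, hgE u])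
    refine ⟨_, hkD, ?_, ?_⟩
    · by_contra hcon
      push Not at hcon
      exact key hcon
    · by_contra hcon
      push Not at hcon
      exact key fun x hx => hH.antipode_antipode_target_of_source hcon hx
  -- Different parameters give different spectra, hence different k, so the family inherits the
  -- uncountability of the interval.
  · have hinj : Set.InjOn k (Set.Ioo 0 δ) := by
      intro t ht t' ht' htt
      by_contra hcon
      refine hne t ht t' ht' hcon ?_
      rw [← (hk t ht).2, ← (hk t' ht').2, htt]
    exact hδ.not_ge (Cardinal.Real.Ioo_countable_iff.1
      (Set.countable_of_injective_of_countable_image hinj hc))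
  · rintro _ ⟨t, ht, rfl⟩
    exact (hk t ht).1
  · rintro _ ⟨t, ht, rfl⟩ _ ⟨t', ht', rfl⟩ hkk
    have h1 : spectrum ℂ ((↑(k t)⁻¹ : A) * G.canonicalElement) ≠
        spectrum ℂ ((↑(k t')⁻¹ : A) * G.canonicalElement) := by
      rw [(hk t ht).2, (hk t' ht').2]
      exact hne t ht t' ht' fun htt => hkk (htt ▸ rfl)
    exact ⟨h1, fun hi => h1 (hspec _ _ (hk t ht).1 (hk t' ht').1 hi)⟩
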